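/- Let $n,p\ge 1$ be integers and let $m_1,\dots,m_p$, $\nu_1,\dots,\nu_p$ be nonnegative integers with $m_1\ge 2n+\nu_1$ and $m_k\ge n+\nu_k+1$ for $2\le k\le p$. For real numbers $a_1,\dots,a_p$, $b_1,\dots,b_p$ and $0<x<1$ let $$G^{p,0}_{p,p}\left(\begin{matrix}a_1,\dots,a_p\\ b_1,\dots,b_p\end{matrix}\Big|\,x\right)=\frac1{2\pi i}\int_C\frac{\prod_{j=1}^p\Gamma(b_j+s)}{\prod_{j=1}^p\Gamma(a_j+s)}\,x^{-s}\,ds$$ be the Meijer $G$-function, where $C$ is a positively oriented contour that starts and ends at $-\infty$ and encircles the negative real axis and all the poles of the integrand. At $x=1$ the functions below are given by their left limits, equivalently by the same integral, taken as the limit over the contours cut off at real part $-R$, $R\to\infty$ (the value is $0$ unless $p=1$ and $m_1=2n+\nu_1$). For a Young diagram $\lambda=(\lambda_1\ge\dots\ge\lambda_n\ge 0)$ with at most $n$ rows and $\epsilon>0$ put $x_j=e^{-\epsilon\lambda_j}$, $1\le j\le n$, and let $s_\lambda$ denote the Schur function. Then, as $\epsilon\to0+$, $$\epsilon^{\sum_{k=1}^p(m_k-n-\nu_k)n-\frac{n(n+1)}2}\,s_\lambda\left(e^{-(1+\nu_1)\epsilon},e^{-(2+\nu_1)\epsilon},\dots,e^{-(m_1-n)\epsilon};\;\dots;\;e^{-(1+\nu_p)\epsilon},e^{-(2+\nu_p)\epsilon},\dots,e^{-(m_p-n)\epsilon}\right)$$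 converges to $$\frac{\Gamma(m_1-2n-\nu_1+1)^n}{\prod_{j=1}^n\Gamma(m_1-2n-\nu_1+j)}\;\det\left[G^{p,0}_{p,p}\left(\begin{matrix}m_p-n+1,&\dots,&m_2-n+1,&m_1-2n+k+1\\ \nu_p+1,&\dots,&\nu_2+1,&\nu_1+k\end{matrix}\Big|\,x_j\right)\right]_{j,k=1}^n,$$ uniformly in $x_1,\dots,x_n\in[0,1]$: for every $\delta>0$ there is $\epsilon_0>0$ such that for all $0<\epsilon<\epsilon_0$ and all Young diagrams $\lambda$ with at most $n$ rows the absolute value of the difference of the two expressions, with $x_j=e^{-\epsilon\lambda_j}$, is less than $\delta$. -/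

import Mathlib

open scoped BigOperators

noncomputable section

/-- Semistandard Young tableaux of shape `μ` all of whose entries lie in `{0, …, N - 1}`. -/
def boundedTableaux (μ : YoungDiagram) (N : ℕ) : Set (SemistandardYoungTableau μ) :=
  {T | ∀ c ∈ μ.cells, T c.1 c.2 < N}

/-- There are only finitely many of them. -/
theorem boundedTableaux_finite (μ : YoungDiagram) (N : ℕ) : (boundedTableaux μ N).Finite := by
  classical
  let F : boundedTableaux μ N → (μ.cells → Fin N) :=
    fun T c => ⟨T.1 c.1.1 c.1.2, T.2 c.1 c.2⟩
  have hF : Function.Injective F := by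
    intro S T h
    apply Subtype.ext
    apply SemistandardYoungTableau.ext
    intro i j
    by_cases hc : (i, j) ∈ μ
    · have h1 := congrFun h ⟨(i, j), hc⟩
      exact congrArg Fin.val h1
    · rw [S.1.zeros hc, T.1.zeros hc]
  have := Finite.of_injective F hF
  exact Set.toFinite _

/-- The Schur function `s_μ(y_0, …, y_{N-1})`, evaluated at the entries of the finite list
`y` of length `N`: the sum, over the semistandard tableaux `T` of shape `μ` with entries in
`{0, …, N - 1}`, of the monomials `∏_{c ∈ μ} y_{T(c)}`. (The default value `0` of `getD` is
never used, since all entries of `T` are smaller than the length of `y`.) -/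
def schurFunction (μ : YoungDiagram) (y : List ℝ) : ℝ :=
  ∑ T ∈ (boundedTableaux_finite μ y.length).toFinset,
    ∏ c ∈ μ.cells, y.getD (T c.1 c.2) 0

/-- The union of the `p` geometric series
`e^{-(1+ν_k)ε}, e^{-(2+ν_k)ε}, …, e^{-(m_k-n)ε}`, `k = 1, …, p`. -/
def geometricSeriesUnion (n p : ℕ) (m ν : ℕ → ℕ) (ε : ℝ) : List ℝ :=
  (List.Ico 1 (p + 1)).flatMap fun k =>
    (List.Ico (1 + ν k) (m k - n + 1)).map fun i => Real.exp (-(i : ℝ) * ε)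

/-- The integrand `∏_j Γ(b_j + s) / ∏_j Γ(a_j + s) · x^{-s}` in the contour integral for
`G^{p,0}_{p,p}`. -/
def meijerIntegrand {p : ℕ} (a b : Fin p → ℝ) (x : ℝ) (s : ℂ) : ℂ :=
  (∏ j, Complex.Gamma ((b j : ℂ) + s)) / (∏ j, Complex.Gamma ((a j : ℂ) + s)) * (x : ℂ) ^ (-s)

/-- The Meijer `G`-function `G^{p,0}_{p,p}(a_1, …, a_p; b_1, …, b_p | x)`, `0 < x < 1`, for real
parameters: `(2πi)⁻¹ ∫_C` of `meijerIntegrand a b x`, where `C` is the positively oriented contour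
that runs from `-∞ - i` to `c - i` along a horizontal line, from `c - i` to `c + i` along a
vertical line, and back to `-∞ + i` along a horizontal line. With `c = 1 + ∑_j |b_j|`,
it encircles the negative real axis and all the poles of the integrand. The two horizontal rays
are integrated together; for `0 < x < 1` each of them converges absolutely, and at `x = 1` this is
the limit of the integrals over the contours cut off at real part `-R`, `R → ∞`,
when the parameters are integers with `a_j - b_j ≥ 1` for all `j`; its value there is the limit
of the values at `x < 1` (which is `0` unless `∑_j (a_j - b_j) = 1`). -/
def meijerG {p : ℕ} (a b : Fin p → ℝ) (x : ℝ) : ℂ :=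
  let c : ℝ := 1 + ∑ j, |b j|
  (2 * (Real.pi : ℂ) * Complex.I)⁻¹ *
    ((∫ t in Set.Iic c, (meijerIntegrand a b x ((t : ℂ) - Complex.I)
        - meijerIntegrand a b x ((t : ℂ) + Complex.I)))
      + Complex.I * ∫ t in (-1 : ℝ)..1, meijerIntegrand a b x ((c : ℂ) + (t : ℂ) * Complex.I))

/-- The upper parameters `m_1-2n+k+1, m_2-n+1, …, m_p-n+1`
(`G` is symmetric in its upper parameters, so their order plays no role). -/
def upperParameters (n p : ℕ) (m : ℕ → ℕ) (k : ℕ) : Fin p → ℝ := fun r =>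
  if (r : ℕ) = 0 then (m 1 : ℝ) - 2 * n + k + 1 else (m (r + 1) : ℝ) - n + 1

/-- The lower parameters `ν_1+k, ν_2+1, …, ν_p+1`
(`G` is symmetric in its lower parameters, so their order plays no role). -/
def lowerParameters (p : ℕ) (ν : ℕ → ℕ) (k : ℕ) : Fin p → ℝ := fun r =>
  if (r : ℕ) = 0 then (ν 1 : ℝ) + k else (ν (r + 1) : ℝ) + 1

end

/-!
The proof goes through determinants of size `n` on both sides.

By the Jacobi–Trudi identity (`schurFunction_eq_det`, proved by peeling off the last variable: the
branching rule for semistandard tableaux matches a row operation on the determinant) the Schur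
function is the determinant of the complete homogeneous functions `h_{λ_i - i + j}` of all the
variables. Applying `∏_{a ∈ S} (E - a)`, with `E` the shift of the index, to the sequence `h`
removes the variables `S`. Hence a change of columns leads to the determinant of the complete
homogeneous functions of the variables that remain when, in the `k`-th column, `n - 1` variables
of the first geometric series are left out, `k` of them at the lower end of the exponents and the
others at the upper end (`k = 0, …, n - 1`). The determinant of this change of columns is computed
against a Vandermonde determinant (`prod_mul_schurFunction_eq_det`); after division by the
appropriate power of `ε` it tends to the reciprocal of the quotient of Gamma values in front of
the limit (`tendsto_columnChange`).

It remains to compare the entries. The quotient of Gamma functions in the integrand of the Meijer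
function is `∏ (a + s)⁻¹`, where `a` runs through the exponents of the variables remaining in the
column. In the variable `u = -log x` the contour integral `hankelKernel` of `e^{us} ∏ (a + s)⁻¹`
therefore solves `G' = g - a G`, where `g` is the kernel with the factor `(a + s)⁻¹` removed
(`hasDerivAt_hankelKernel_cons`). Its value at `u = 0` is `1` for one factor and `0` for several
(`hankelKernel_singleton_zero`, `hankelKernel_zero`). The rescaled complete homogeneous functions
of the `e^{-aε}` satisfy the corresponding difference equation, and the accumulated error is
`O(ε)` uniformly in the index because `a ≥ 1` (`exists_norm_completeHomogeneous_sub_le`). The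
theorem follows since `(t, M) ↦ t det M` is uniformly continuous on compact sets.
-/

/-! ### Complete homogeneous functions and Young diagrams -/

/-- The complete homogeneous symmetric function `h_r` of the entries of the list `y`, with the
convention `h_r = 0` for `r < 0`, read off from the generating series `∏ (1 - a X)⁻¹`. -/
noncomputable def completeHomogeneous (y : List ℝ) (r : ℤ) : ℝ :=
  if r < 0 then 0
  else PowerSeries.coeff r.toNat (y.map fun a => PowerSeries.mk fun k => a ^ k).prod

theorem completeHomogeneous_of_neg (y : List ℝ) {r : ℤ} (hr : r < 0) :
    completeHomogeneous y r = 0 := if_pos hr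

theorem completeHomogeneous_nil (r : ℤ) :
    completeHomogeneous [] r = if r = 0 then 1 else 0 := by
  unfold completeHomogeneous
  simp only [List.map_nil, List.prod_nil, PowerSeries.coeff_one]
  split_ifs <;> first | rfl | omega

theorem completeHomogeneous_perm {y y' : List ℝ} (h : y.Perm y') :
    completeHomogeneous y = completeHomogeneous y' := by
  funext r
  unfold completeHomogeneous
  rw [(h.map _).prod_eq]

/-- The recursion in the number of variables. It holds for every integer index: at `r = -1` it says
that `h_0` does not depend on the variables. -/
theorem completeHomogeneous_cons (a : ℝ) (y : List ℝ) (r : ℤ) :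
    completeHomogeneous (a :: y) (r + 1)
      = a * completeHomogeneous (a :: y) r + completeHomogeneous y (r + 1) := by
  have key : ∀ P : PowerSeries ℝ, (PowerSeries.mk fun k => a ^ k) * P
      = P + PowerSeries.C a * (PowerSeries.X * ((PowerSeries.mk fun k => a ^ k) * P)) := by
    intro P
    have h1 : (PowerSeries.mk fun k => a ^ k : PowerSeries ℝ)
        = 1 + PowerSeries.C a * (PowerSeries.X * (PowerSeries.mk fun k => a ^ k)) := by
      ext k
      cases k with
      | zero => simp
      | succ k =>
        simp [PowerSeries.coeff_succ_X_mul, PowerSeries.coeff_one, pow_succ']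
    calc _ = (1 + PowerSeries.C a * (PowerSeries.X * (PowerSeries.mk fun k => a ^ k))) * P := by
            rw [← h1]
      _ = _ := by ring
  unfold completeHomogeneous
  simp only [List.map_cons, List.prod_cons]
  rcases lt_trichotomy r (-1) with h | h | h
  · rw [if_pos (by omega), if_pos (by omega), if_pos (by omega)]; ring
  · subst h
    rw [if_neg (by omega), if_pos (by omega), if_neg (by omega), key]
    simp
  · rw [if_neg (by omega), if_neg (by omega), if_neg (by omega), key]
    obtain ⟨k, rfl⟩ := Int.eq_ofNat_of_zero_le (show 0 ≤ r by omega)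
    have h2 : ((k : ℤ) + 1).toNat = k + 1 := by omega
    rw [h2, map_add, PowerSeries.coeff_C_mul, PowerSeries.coeff_succ_X_mul]
    rw [← key]
    simp [add_comm]

theorem completeHomogeneous_zero (y : List ℝ) : completeHomogeneous y 0 = 1 := by
  induction y with
  | nil => simp [completeHomogeneous_nil]
  | cons a y ih =>
    have := completeHomogeneous_cons a y (-1)
    rw [completeHomogeneous_of_neg _ (by norm_num : (-1 : ℤ) < 0)] at this
    simpa [ih] using this

/-- Unrolling a first order recursion `w (r + 1) = a w r + v (r + 1)` over `d` steps. -/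
theorem sub_pow_smul_eq_sum {E : Type*} [AddCommGroup E] [Module ℝ E] {a : ℝ} {v w : ℤ → E}
    (hw : ∀ r, w (r + 1) = a • w r + v (r + 1)) (b : ℤ) (d : ℕ) :
    w (b + d) - a ^ d • w b = ∑ k ∈ Finset.Icc 1 d, a ^ (d - k) • v (b + k) := by
  induction d with
  | zero => simp
  | succ d ih =>
    rw [Finset.sum_Icc_succ_top (by omega)]
    have h1 : ∑ k ∈ Finset.Icc 1 d, a ^ (d + 1 - k) • v (b + k)
        = a • ∑ k ∈ Finset.Icc 1 d, a ^ (d - k) • v (b + k) := by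
      rw [Finset.smul_sum]
      refine Finset.sum_congr rfl fun k hk => ?_
      rw [smul_smul, ← pow_succ']
      congr 2
      have := (Finset.mem_Icc.1 hk).2
      omega
    rw [h1, ← ih]
    push_cast
    rw [← add_assoc, hw, pow_succ']
    simp only [smul_sub, smul_smul, Nat.sub_self, pow_zero, one_smul]
    abel

/-- The branching rule for determinants of Jacobi–Trudi type: subtracting from each row a multiple
of the next one turns the rows of the left side into sums over the intervals
`[f (i + 1), f i]`, which are expanded by multilinearity. -/
theorem det_branching {n : ℕ} {a : ℝ} {v w : ℤ → Fin n → ℝ}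
    (hw : ∀ r, w (r + 1) = a • w r + v (r + 1)) (hw0 : ∀ r : ℤ, r ≤ -n → w r = 0)
    {f : ℕ → ℕ} (hf : Antitone f) (hfn : f n = 0) :
    Matrix.det (Matrix.of fun i : Fin n => w ((f i : ℤ) - (i : ℕ)))
      = ∑ g ∈ Fintype.piFinset (fun i : Fin n => Finset.Icc (f (i + 1)) (f i)),
          a ^ (∑ i : Fin n, (f i - g i))
            * Matrix.det (Matrix.of fun i : Fin n => v ((g i : ℤ) - (i : ℕ))) := by
  -- `U` subtracts `c i` times row `i + 1` from row `i`.
  -- For the last row the row below is `w (-n) = 0`.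
  set c : Fin n → ℝ := fun i => a ^ (f i - f (i + 1) + 1) with hc
  set U : Matrix (Fin n) (Fin n) ℝ :=
    Matrix.of fun i k => if i = k then 1 else if (k : ℕ) = i + 1 then -c i else 0 with hU
  have hUdet : U.det = 1 := by
    rw [Matrix.det_of_isUpperTriangular]
    · simp [hU]
    · intro i k hik
      have hik' : k < i := hik
      have h1 : i ≠ k := ne_of_gt hik'
      have h2 : ¬ ((k : ℕ) = i + 1) := by
        have : (k : ℕ) < i := hik'
        omega
      simp [hU, h1, h2]
  have hrow : ∀ i : Fin n, w ((f i : ℤ) - (i : ℕ)) - c i • w ((f (i + 1) : ℤ) - ((i : ℕ) + 1 : ℕ))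
      = ∑ g ∈ Finset.Icc (f (i + 1)) (f i), a ^ (f i - g) • v ((g : ℤ) - (i : ℕ)) := by
    intro i
    have hle : f (i + 1) ≤ f i := hf (Nat.le_succ _)
    have h := sub_pow_smul_eq_sum hw ((f (i + 1) : ℤ) - ((i : ℕ) + 1 : ℕ)) (f i - f (i + 1) + 1)
    have e1 : ((f (i + 1) : ℤ) - ((i : ℕ) + 1 : ℕ)) + ((f i - f (i + 1) + 1 : ℕ) : ℤ)
        = (f i : ℤ) - (i : ℕ) := by
      push_cast [Nat.cast_sub hle]; ring
    rw [e1] at h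
    rw [hc]
    simp only
    rw [h]
    refine Finset.sum_bij' (fun k _ => k + f (i + 1) - 1) (fun g _ => g + 1 - f (i + 1))
      ?_ ?_ ?_ ?_ ?_
    · intro k hk; simp only [Finset.mem_Icc] at hk ⊢; omega
    · intro k hk; simp only [Finset.mem_Icc] at hk ⊢; omega
    · intro k hk; simp only [Finset.mem_Icc] at hk; omega
    · intro k hk; simp only [Finset.mem_Icc] at hk; omega
    · intro k hk
      simp only [Finset.mem_Icc] at hk
      congr 2
      · omega
      · have : ((k + f (i + 1) - 1 : ℕ) : ℤ) = k + f (i + 1) - 1 := by omega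
        rw [this]; push_cast; ring
  have hmul : U * Matrix.of (fun i : Fin n => w ((f i : ℤ) - (i : ℕ)))
      = Matrix.of fun i : Fin n =>
        ∑ g ∈ Finset.Icc (f (i + 1)) (f i), a ^ (f i - g) • v ((g : ℤ) - (i : ℕ)) := by
    ext i j
    rw [Matrix.of_apply, ← hrow i, Matrix.mul_apply]
    have hsplit : ∀ k : Fin n, U i k * w ((f k : ℤ) - (k : ℕ)) j
        = (if i = k then w ((f k : ℤ) - (k : ℕ)) j else 0)
          + (if (k : ℕ) = i + 1 then -c i * w ((f k : ℤ) - (k : ℕ)) j else 0) := by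
      intro k
      by_cases h1 : i = k
      · subst h1; simp [hU]
      · by_cases h2 : (k : ℕ) = i + 1 <;> simp [hU, h1, h2]
    simp only [Matrix.of_apply]
    rw [Finset.sum_congr rfl fun k _ => hsplit k, Finset.sum_add_distrib]
    simp only [Finset.sum_ite_eq, Finset.mem_univ, if_true, Pi.sub_apply, Pi.smul_apply,
      smul_eq_mul, sub_eq_add_neg]
    congr 1
    by_cases hi : (i : ℕ) + 1 < n
    · rw [Finset.sum_eq_single (⟨i + 1, hi⟩ : Fin n)]
      · simp
      · intro k _ hk
        rw [if_neg]
        intro h; exact hk (Fin.ext h)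
      · simp
    · have hi' : (i : ℕ) + 1 = n := by have := i.2; omega
      rw [Finset.sum_eq_zero, hi', hfn, hw0 _ (by simp)]
      · simp
      · intro k _
        rw [if_neg]
        have := k.2; omega
  have hdet : Matrix.det (Matrix.of fun i : Fin n => w ((f i : ℤ) - (i : ℕ)))
      = Matrix.det (Matrix.of fun i : Fin n =>
        ∑ g ∈ Finset.Icc (f (i + 1)) (f i), a ^ (f i - g) • v ((g : ℤ) - (i : ℕ))) := by
    rw [← hmul, Matrix.det_mul, hUdet, one_mul]
  rw [hdet]
  -- Expand the determinant by multilinearity in the rows.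
  have := (Matrix.detRowAlternating (n := Fin n) (R := ℝ)).toMultilinearMap.map_sum_finset
    (fun i g => a ^ (f i - g) • v ((g : ℤ) - (i : ℕ))) (fun i => Finset.Icc (f (i + 1)) (f i))
  refine this.trans (Finset.sum_congr rfl fun g _ => ?_)
  rw [MultilinearMap.map_smul_univ, Finset.prod_pow_eq_pow_sum]
  rfl

/-- The Young diagram generated by rows of lengths `g 0, …, g (n - 1)`: the smallest one that
contains them. If `g` is antitone, its row lengths are the values of `g`. -/
def diagramOfRows {n : ℕ} (g : Fin n → ℕ) : YoungDiagram where
  cells := Finset.univ.biUnion fun k : Fin n => Finset.range (k + 1) ×ˢ Finset.range (g k)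
  isLowerSet := by
    rintro ⟨i, j⟩ ⟨i', j'⟩ ⟨h1, h2⟩ h
    simp only [Finset.coe_biUnion, Set.mem_iUnion, Finset.mem_coe, Finset.mem_univ,
      Finset.mem_product, Finset.mem_range, exists_prop, true_and] at h ⊢ h1 h2
    obtain ⟨k, hk1, hk2⟩ := h
    exact ⟨k, by omega, by omega⟩

theorem mem_diagramOfRows {n : ℕ} {g : Fin n → ℕ} {i j : ℕ} :
    (i, j) ∈ diagramOfRows g ↔ ∃ k : Fin n, i ≤ k ∧ j < g k := by
  rw [← YoungDiagram.mem_cells]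
  simp [diagramOfRows]

theorem mem_diagramOfRows_of_antitone {n : ℕ} {g : Fin n → ℕ} (hg : Antitone g) {i j : ℕ} :
    (i, j) ∈ diagramOfRows g ↔ ∃ h : i < n, j < g ⟨i, h⟩ := by
  rw [mem_diagramOfRows]
  constructor
  · rintro ⟨k, h1, h2⟩
    exact ⟨lt_of_le_of_lt h1 k.2, h2.trans_le (hg h1)⟩
  · rintro ⟨h1, h2⟩
    exact ⟨⟨i, h1⟩, le_rfl, h2⟩

theorem rowLen_diagramOfRows {n : ℕ} {g : Fin n → ℕ} (hg : Antitone g) (i : Fin n) :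
    (diagramOfRows g).rowLen i = g i := by
  refine eq_of_forall_lt_iff fun j => ?_
  rw [← YoungDiagram.mem_iff_lt_rowLen, mem_diagramOfRows_of_antitone hg]
  simp

theorem colLen_diagramOfRows {n : ℕ} (g : Fin n → ℕ) : (diagramOfRows g).colLen 0 ≤ n := by
  by_contra! h
  rw [← YoungDiagram.mem_iff_lt_colLen, mem_diagramOfRows] at h
  obtain ⟨k, h1, -⟩ := h
  have := k.2
  omega

theorem rowLen_eq_zero_of_colLen_le {n : ℕ} {μ : YoungDiagram} (hμ : μ.colLen 0 ≤ n) {i : ℕ}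
    (hi : n ≤ i) : μ.rowLen i = 0 := by
  by_contra h
  have h1 : (i, 0) ∈ μ := YoungDiagram.mem_iff_lt_rowLen.2 (Nat.pos_of_ne_zero h)
  rw [YoungDiagram.mem_iff_lt_colLen] at h1
  omega

theorem card_cells_eq_sum_rowLen {n : ℕ} {μ : YoungDiagram} (hμ : μ.colLen 0 ≤ n) :
    μ.cells.card = ∑ i : Fin n, μ.rowLen i := by
  rw [Finset.card_eq_sum_card_fiberwise (f := Prod.fst) (t := Finset.range n),
    Finset.sum_range]
  · refine Finset.sum_congr rfl fun i _ => ?_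
    rw [YoungDiagram.rowLen_eq_card]
    rfl
  · rintro ⟨i, j⟩ hc
    have hc' : (i, j) ∈ μ := hc
    rw [YoungDiagram.mem_iff_lt_rowLen] at hc'
    simp only [Finset.coe_range, Set.mem_Iio]
    by_contra! h
    rw [rowLen_eq_zero_of_colLen_le hμ h] at hc'
    omega

/-! ### Branching of tableaux and the Jacobi–Trudi identity -/

/-- The cells of a semistandard tableau with entries smaller than `N`; they form a Young
diagram. -/
def sublevelDiagram {μ : YoungDiagram} (T : SemistandardYoungTableau μ) (N : ℕ) :
    YoungDiagram where
  cells := μ.cells.filter fun c => T c.1 c.2 < N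
  isLowerSet := by
    rintro ⟨i, j⟩ ⟨i', j'⟩ ⟨h1, h2⟩ h
    simp only [Finset.coe_filter, Set.mem_ofPred_eq, YoungDiagram.mem_cells] at h ⊢ h1 h2
    have h3 : (i, j') ∈ μ := μ.up_left_mem le_rfl h2 h.1
    refine ⟨μ.up_left_mem h1 h2 h.1, ?_⟩
    exact ((T.col_weak h1 h3).trans (T.row_weak_of_le h2 h.1)).trans_lt h.2

theorem mem_sublevelDiagram {μ : YoungDiagram} {T : SemistandardYoungTableau μ} {N i j : ℕ} :
    (i, j) ∈ sublevelDiagram T N ↔ (i, j) ∈ μ ∧ T i j < N := by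
  rw [← YoungDiagram.mem_cells]
  simp [sublevelDiagram]

/-- Restriction of a tableau to a smaller diagram. -/
def SemistandardYoungTableau.restrict {μ κ : YoungDiagram} (T : SemistandardYoungTableau μ)
    (h : κ ≤ μ) : SemistandardYoungTableau κ where
  entry i j := if (i, j) ∈ κ then T i j else 0
  row_weak' := by
    intro i j1 j2 hj hc
    rw [if_pos hc, if_pos (κ.up_left_mem le_rfl hj.le hc)]
    exact T.row_weak hj (h hc)
  col_strict' := by
    intro i1 i2 j hi hc
    rw [if_pos hc, if_pos (κ.up_left_mem hi.le le_rfl hc)]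
    exact T.col_strict hi (h hc)
  zeros' := fun hc => if_neg hc

/-- Extension of a tableau `T` with entries smaller than `N` to a larger diagram, by the entry `N`
in the new cells; these must form a horizontal strip. -/
def SemistandardYoungTableau.extend {μ κ : YoungDiagram} (T : SemistandardYoungTableau κ) (N : ℕ)
    (hT : T ∈ boundedTableaux κ N) (h : κ ≤ μ)
    (hs : ∀ i j, (i + 1, j) ∈ μ → (i, j) ∈ κ) : SemistandardYoungTableau μ where
  entry i j := if (i, j) ∈ κ then T i j else if (i, j) ∈ μ then N else 0
  row_weak' := by
    intro i j1 j2 hj hc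
    have h1 := μ.up_left_mem le_rfl hj.le hc
    by_cases h2 : (i, j2) ∈ κ
    · have h3 := κ.up_left_mem le_rfl hj.le h2
      rw [if_pos h2, if_pos h3]
      exact T.row_weak hj h2
    · rw [if_neg h2, if_pos hc]
      by_cases h3 : (i, j1) ∈ κ
      · rw [if_pos h3]
        exact (hT (i, j1) h3).le
      · rw [if_neg h3, if_pos h1]
  col_strict' := by
    intro i1 i2 j hi hc
    have h3 : (i1, j) ∈ κ := hs i1 j (μ.up_left_mem hi le_rfl hc)
    rw [if_pos h3]
    by_cases h2 : (i2, j) ∈ κ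
    · rw [if_pos h2]
      exact T.col_strict hi h2
    · rw [if_neg h2, if_pos hc]
      exact hT (i1, j) h3
  zeros' := by
    intro i j hc
    rw [if_neg fun h' => hc (h h'), if_neg hc]

theorem SemistandardYoungTableau.restrict_apply {μ κ : YoungDiagram}
    (T : SemistandardYoungTableau μ) (h : κ ≤ μ) (i j : ℕ) :
    T.restrict h i j = if (i, j) ∈ κ then T i j else 0 := rfl

theorem SemistandardYoungTableau.extend_apply {μ κ : YoungDiagram}
    (T : SemistandardYoungTableau κ) (N : ℕ) (hT : T ∈ boundedTableaux κ N) (h : κ ≤ μ)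
    (hs : ∀ i j, (i + 1, j) ∈ μ → (i, j) ∈ κ) (i j : ℕ) :
    T.extend N hT h hs i j = if (i, j) ∈ κ then T i j else if (i, j) ∈ μ then N else 0 := rfl

theorem schurFunction_eq_sum (μ : YoungDiagram) (y : List ℝ) {N : ℕ} (hN : y.length = N) :
    schurFunction μ y = ∑ T ∈ (boundedTableaux_finite μ N).toFinset,
      ∏ c ∈ μ.cells, y.getD (T c.1 c.2) 0 := by
  subst hN; rfl

open Classical in
/-- The contribution to a Schur function in one more variable `a` of the tableaux in which the
cells with an entry other than the largest one fill a given diagram `κ`. -/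
theorem sum_tableaux_sublevelDiagram_eq {μ κ : YoungDiagram} (y : List ℝ) (a : ℝ) (h : κ ≤ μ)
    (hs : ∀ i j, (i + 1, j) ∈ μ → (i, j) ∈ κ) :
    ∑ T ∈ (boundedTableaux_finite μ (y.length + 1)).toFinset with
        sublevelDiagram T y.length = κ,
      ∏ c ∈ μ.cells, (y ++ [a]).getD (T c.1 c.2) 0
    = a ^ (μ.cells.card - κ.cells.card) * schurFunction κ y := by
  classical
  have hsub : κ.cells ⊆ μ.cells := YoungDiagram.cells_subset_iff.2 h
  unfold schurFunction
  rw [Finset.mul_sum]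
  refine Finset.sum_bij'
    (fun T _ => T.restrict h)
    (fun T hT => T.extend y.length ((Set.Finite.mem_toFinset _).1 hT) h hs) ?_ ?_ ?_ ?_ ?_
  · intro T hT
    simp only [Finset.mem_filter, Set.Finite.mem_toFinset] at hT ⊢
    rintro ⟨i, j⟩ hc
    rw [YoungDiagram.mem_cells] at hc
    simp only [SemistandardYoungTableau.restrict_apply, if_pos hc]
    rw [← hT.2, mem_sublevelDiagram] at hc
    exact hc.2
  · intro T hT
    simp only [Set.Finite.mem_toFinset] at hT
    simp only [Finset.mem_filter, Set.Finite.mem_toFinset]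
    constructor
    · rintro ⟨i, j⟩ hc
      rw [YoungDiagram.mem_cells] at hc
      simp only [SemistandardYoungTableau.extend_apply]
      split_ifs with h1
      · exact (hT (i, j) h1).trans (Nat.lt_succ_self _)
      · exact Nat.lt_succ_self _
    · apply YoungDiagram.ext
      ext ⟨i, j⟩
      rw [YoungDiagram.mem_cells, YoungDiagram.mem_cells, mem_sublevelDiagram,
        SemistandardYoungTableau.extend_apply]
      constructor
      · rintro ⟨h1, h2⟩
        by_contra h3
        rw [if_neg h3, if_pos h1] at h2
        exact lt_irrefl _ h2
      · intro h1
        rw [if_pos h1]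
        exact ⟨h h1, hT (i, j) h1⟩
  · intro T hT
    simp only [Finset.mem_filter, Set.Finite.mem_toFinset] at hT
    ext i j
    rw [SemistandardYoungTableau.extend_apply, SemistandardYoungTableau.restrict_apply]
    split_ifs with h1 h2
    · rfl
    · have h3 : ¬ T i j < y.length := by
        intro h4
        exact h1 (hT.2 ▸ mem_sublevelDiagram.2 ⟨h2, h4⟩)
      have h5 : T i j < y.length + 1 := hT.1 (i, j) h2
      omega
    · exact (T.zeros h2).symm
  · intro T hT
    ext i j
    rw [SemistandardYoungTableau.restrict_apply, SemistandardYoungTableau.extend_apply]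
    split_ifs with h1
    · rfl
    · exact (T.zeros h1).symm
  · intro T hT
    simp only [Finset.mem_filter, Set.Finite.mem_toFinset] at hT
    rw [← Finset.prod_sdiff hsub, ← Finset.card_sdiff_of_subset hsub, ← Finset.prod_const]
    congr 1
    · refine Finset.prod_congr rfl ?_
      rintro ⟨i, j⟩ hc
      rw [Finset.mem_sdiff, YoungDiagram.mem_cells, YoungDiagram.mem_cells] at hc
      have h3 : ¬ T i j < y.length := by
        intro h4
        exact hc.2 (hT.2 ▸ mem_sublevelDiagram.2 ⟨hc.1, h4⟩)
      have h5 : T i j < y.length + 1 := hT.1 (i, j) hc.1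
      have h6 : T i j = y.length := by omega
      simp [h6]
    · refine Finset.prod_congr rfl ?_
      rintro ⟨i, j⟩ hc
      rw [YoungDiagram.mem_cells] at hc
      simp only [SemistandardYoungTableau.restrict_apply, if_pos hc]
      have hc2 := hc
      rw [← hT.2, mem_sublevelDiagram] at hc2
      exact List.getD_append _ _ _ _ hc2.2

/-- The branching rule for Schur functions: removing the last variable gives a sum over the
diagrams that interlace with the given one. -/
theorem schurFunction_append_singleton {n : ℕ} {μ : YoungDiagram} (hμ : μ.colLen 0 ≤ n)
    (y : List ℝ) (a : ℝ) :
    schurFunction μ (y ++ [a])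
      = ∑ g ∈ Fintype.piFinset
          (fun i : Fin n => Finset.Icc (μ.rowLen (i + 1)) (μ.rowLen i)),
          a ^ (∑ i : Fin n, (μ.rowLen i - g i)) * schurFunction (diagramOfRows g) y := by
  classical
  rw [schurFunction_eq_sum μ (y ++ [a]) (N := y.length + 1) (by simp)]
  -- Sort the tableaux by the shape formed by the cells without the largest entry.
  rw [← Finset.sum_fiberwise_of_maps_to
    (g := fun T => fun i : Fin n => (sublevelDiagram T y.length).rowLen i)
    (t := Fintype.piFinset (fun i : Fin n => Finset.Icc (μ.rowLen (i + 1)) (μ.rowLen i)))]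
  · refine Finset.sum_congr rfl fun g hg => ?_
    rw [Fintype.mem_piFinset] at hg
    simp only [Finset.mem_Icc] at hg
    have hanti : Antitone g := by
      intro i k hik
      rcases hik.eq_or_lt with rfl | hlt
      · exact le_rfl
      · exact ((hg k).2.trans (μ.rowLen_anti (i + 1) k hlt)).trans (hg i).1
    have hle : diagramOfRows g ≤ μ := by
      rintro ⟨i, j⟩ hc
      obtain ⟨hi, hj⟩ := (mem_diagramOfRows_of_antitone hanti).1 hc
      exact YoungDiagram.mem_iff_lt_rowLen.2 (hj.trans_le (hg ⟨i, hi⟩).2)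
    have hs : ∀ i j, (i + 1, j) ∈ μ → (i, j) ∈ diagramOfRows g := by
      intro i j hc
      rw [YoungDiagram.mem_iff_lt_rowLen] at hc
      have hi : i < n := by
        by_contra! hi
        rw [rowLen_eq_zero_of_colLen_le hμ (by omega)] at hc
        omega
      exact (mem_diagramOfRows_of_antitone hanti).2 ⟨hi, hc.trans_le (hg ⟨i, hi⟩).1⟩
    have hcard : μ.cells.card - (diagramOfRows g).cells.card
        = ∑ i : Fin n, (μ.rowLen i - g i) := by
      rw [card_cells_eq_sum_rowLen hμ, card_cells_eq_sum_rowLen (colLen_diagramOfRows g),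
        Finset.sum_congr rfl fun i _ => rowLen_diagramOfRows hanti i,
        Finset.sum_tsub_distrib _ fun i _ => (hg i).2]
    rw [← hcard, ← sum_tableaux_sublevelDiagram_eq y a hle hs]
    refine Finset.sum_congr (Finset.filter_congr fun T _ => ?_) fun _ _ => rfl
    constructor
    · intro h
      apply YoungDiagram.ext
      ext ⟨i, j⟩
      rw [YoungDiagram.mem_cells, YoungDiagram.mem_cells, mem_diagramOfRows_of_antitone hanti,
        ← h]
      constructor
      · intro hc
        have h2 := YoungDiagram.mem_iff_lt_rowLen.1 (mem_sublevelDiagram.1 hc).1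
        have hi : i < n := by
          by_contra! hi
          rw [rowLen_eq_zero_of_colLen_le hμ (by omega)] at h2
          omega
        exact ⟨hi, YoungDiagram.mem_iff_lt_rowLen.1 hc⟩
      · rintro ⟨hi, hj⟩
        exact YoungDiagram.mem_iff_lt_rowLen.2 hj
    · intro h
      funext i
      rw [h, rowLen_diagramOfRows hanti]
  · intro T hT
    rw [Set.Finite.mem_toFinset] at hT
    rw [Fintype.mem_piFinset]
    intro i
    rw [Finset.mem_Icc]
    constructor
    · refine le_of_forall_lt fun j hj => ?_
      rw [← YoungDiagram.mem_iff_lt_rowLen] at hj ⊢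
      rw [mem_sublevelDiagram]
      refine ⟨μ.up_left_mem (Nat.le_succ _) le_rfl hj, ?_⟩
      have h1 : T i j < T (i + 1) j := T.col_strict (Nat.lt_succ_self _) hj
      have h2 : T (i + 1) j < y.length + 1 := hT (_, j) hj
      omega
    · refine le_of_forall_lt fun j hj => ?_
      rw [← YoungDiagram.mem_iff_lt_rowLen] at hj ⊢
      exact (mem_sublevelDiagram.1 hj).1

open Classical in
theorem schurFunction_nil (μ : YoungDiagram) :
    schurFunction μ [] = if μ = ⊥ then 1 else 0 := by
  rw [schurFunction_eq_sum μ [] (N := 0) rfl]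
  split_ifs with h
  · subst h
    have h1 : (boundedTableaux_finite ⊥ 0).toFinset = {default} := by
      ext T
      simp only [Set.Finite.mem_toFinset, Finset.mem_singleton]
      constructor
      · intro _
        ext i j
        rw [T.zeros (YoungDiagram.notMem_bot _),
          SemistandardYoungTableau.zeros _ (YoungDiagram.notMem_bot _)]
      · intro _ c hc
        simp at hc
    rw [h1]
    simp
  · refine Finset.sum_eq_zero fun T hT => ?_
    exfalso
    apply h
    rw [Set.Finite.mem_toFinset] at hT
    apply YoungDiagram.ext
    rw [YoungDiagram.cells_bot]
    refine Finset.eq_empty_of_forall_notMem fun c hc => ?_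
    exact Nat.not_lt_zero _ (hT c hc)

/-- The Jacobi–Trudi identity. Both sides obey the same branching rule in the last variable. -/
theorem schurFunction_eq_det {n : ℕ} (y : List ℝ) (μ : YoungDiagram) (hμ : μ.colLen 0 ≤ n) :
    schurFunction μ y = Matrix.det (Matrix.of fun i j : Fin n =>
      completeHomogeneous y ((μ.rowLen i : ℤ) - (i : ℕ) + (j : ℕ))) := by
  induction y using List.reverseRecOn generalizing μ with
  | nil =>
    rw [schurFunction_nil, Matrix.det_of_isLowerTriangular]
    · simp only [Matrix.of_apply, completeHomogeneous_nil]
      split_ifs with h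
      · subst h
        have h0 : ∀ i, (⊥ : YoungDiagram).rowLen i = 0 := by
          intro i
          by_contra h
          exact YoungDiagram.notMem_bot (i, 0)
            (YoungDiagram.mem_iff_lt_rowLen.2 (Nat.pos_of_ne_zero h))
        simp [h0]
      · symm
        by_contra hne
        apply h
        apply YoungDiagram.ext
        rw [YoungDiagram.cells_bot, ← Finset.card_eq_zero, card_cells_eq_sum_rowLen hμ]
        refine Finset.sum_eq_zero fun i _ => ?_
        have := (Finset.prod_ne_zero_iff.1 hne) i (Finset.mem_univ _)
        by_contra h2
        apply this
        rw [if_neg]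
        omega
    · intro i j hij
      have hij' : (i : ℕ) < j := hij
      simp only [Matrix.of_apply, completeHomogeneous_nil]
      rw [if_neg]
      omega
  | append_singleton y a ih =>
    rw [schurFunction_append_singleton hμ,
      completeHomogeneous_perm (List.perm_append_singleton a y)]
    have := det_branching (n := n) (a := a)
      (v := fun r j => completeHomogeneous y (r + (j : ℕ)))
      (w := fun r j => completeHomogeneous (a :: y) (r + (j : ℕ))) (f := μ.rowLen)
      (fun r => by
        funext j
        have := completeHomogeneous_cons a y (r + (j : ℕ))
        simp only [Pi.add_apply, Pi.smul_apply, smul_eq_mul]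
        rw [show r + 1 + ((j : ℕ) : ℤ) = r + (j : ℕ) + 1 by ring]
        exact this)
      (fun r hr => by
        funext j
        have := j.2
        exact completeHomogeneous_of_neg _ (by omega))
      (fun i k hik => μ.rowLen_anti i k hik)
      (rowLen_eq_zero_of_colLen_le hμ le_rfl)
    refine Eq.trans ?_ this.symm
    refine Finset.sum_congr rfl fun g hg => ?_
    have hg' : ∀ i : Fin n, μ.rowLen (i + 1) ≤ g i ∧ g i ≤ μ.rowLen i := fun i =>
      Finset.mem_Icc.1 (Fintype.mem_piFinset.1 hg i)
    have hanti : Antitone g := by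
      intro i k hik
      rcases hik.eq_or_lt with rfl | hlt
      · exact le_rfl
      · exact ((hg' k).2.trans (μ.rowLen_anti (i + 1) k hlt)).trans (hg' i).1
    rw [ih _ (colLen_diagramOfRows g)]
    simp only [rowLen_diagramOfRows hanti]

/-! ### Leaving out variables column by column -/

theorem funLeft_add_one_pow_apply (v : ℤ → ℝ) (j : ℕ) (r : ℤ) :
    ((LinearMap.funLeft ℝ ℝ fun r : ℤ => r + 1) ^ j) v r = v (r + j) := by
  induction j generalizing v with
  | zero => simp
  | succ j ih =>
    rw [pow_succ, Module.End.mul_apply, ih, LinearMap.funLeft_apply]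
    push_cast
    rw [add_assoc]

/-- Applying `∏_{a ∈ S} (E - a)`, with `E` the shift `r ↦ r + 1`, to the complete homogeneous
functions removes the variables `S`. -/
theorem aeval_shift_completeHomogeneous (S l : List ℝ) :
    Polynomial.aeval (LinearMap.funLeft ℝ ℝ fun r : ℤ => r + 1)
        (S.map fun a => Polynomial.X - Polynomial.C a).prod (completeHomogeneous (S ++ l))
      = fun r => completeHomogeneous l (r + S.length) := by
  induction S generalizing l with
  | nil => simp
  | cons a S ih =>
    have hp : completeHomogeneous (a :: S ++ l) = completeHomogeneous (S ++ a :: l) :=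
      completeHomogeneous_perm List.perm_middle.symm
    rw [List.map_cons, List.prod_cons, map_mul, Module.End.mul_apply, hp, ih]
    funext r
    rw [map_sub, Polynomial.aeval_X, Polynomial.aeval_C, LinearMap.sub_apply, Pi.sub_apply,
      LinearMap.funLeft_apply, Module.algebraMap_end_apply, Pi.smul_apply, smul_eq_mul,
      List.length_cons]
    have := completeHomogeneous_cons a l (r + S.length)
    push_cast
    rw [add_right_comm, this, add_assoc]
    ring

theorem natDegree_prod_X_sub_C_list (S : List ℝ) :
    (S.map fun a => (Polynomial.X - Polynomial.C a : Polynomial ℝ)).prod.natDegree = S.length := by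
  have := Polynomial.natDegree_multiset_prod_X_sub_C_eq_card (S : Multiset ℝ)
  simpa using this

/-- Combining the columns `h_{r + j}`, `j < n`, with the coefficients of `∏_{a ∈ S} (X - a)` removes
the `n - 1` variables `S`. -/
theorem sum_coeff_mul_completeHomogeneous {n : ℕ} {S l y : List ℝ} (hS : S.length + 1 = n)
    (hp : (S ++ l).Perm y) (r : ℤ) :
    ∑ j : Fin n, completeHomogeneous y (r + (j : ℕ)) *
        (S.map fun a => (Polynomial.X - Polynomial.C a : Polynomial ℝ)).prod.coeff j
      = completeHomogeneous l (r + n - 1) := by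
  have h1 := congrFun (aeval_shift_completeHomogeneous S l) r
  rw [Polynomial.aeval_eq_sum_range' (n := n) (by rw [natDegree_prod_X_sub_C_list]; omega),
    LinearMap.sum_apply, Finset.sum_apply, completeHomogeneous_perm hp, Finset.sum_range] at h1
  rw [show r + n - 1 = r + S.length by rw [← hS]; push_cast; ring, ← h1]
  refine Finset.sum_congr rfl fun j _ => ?_
  rw [LinearMap.smul_apply, Pi.smul_apply, funLeft_add_one_pow_apply, smul_eq_mul, mul_comm]

theorem Fin.prod_Iio_val {n : ℕ} (k : Fin n) (f : ℕ → ℝ) :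
    ∏ i ∈ Finset.Iio k, f i = ((List.range k).map f).prod := by
  have h := Finset.prod_map (Finset.Iio k) Fin.valEmbedding f
  rw [Fin.map_valEmbedding_Iio, Nat.Iio_eq_range] at h
  exact h.symm

/-- The coefficient matrix of the polynomials `∏_{i < k} (X - w_i) · ∏_{a ∈ T_k} (X - a)`, of degree
`n - 1`, has determinant `∏_k ∏_{a ∈ T_k} (w_k - a)`: multiplied by the Vandermonde matrix of
`w` it becomes triangular. -/
theorem det_coeff_prod_X_sub_C {n : ℕ} (w : ℕ → ℝ) (hw : Function.Injective w)
    (T : Fin n → List ℝ) (hT : ∀ k : Fin n, (k : ℕ) + (T k).length + 1 = n) :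
    Matrix.det (Matrix.of fun j k : Fin n =>
        (((List.range k).map w ++ T k).map fun a =>
          (Polynomial.X - Polynomial.C a : Polynomial ℝ)).prod.coeff j)
      = ∏ k : Fin n, ((T k).map fun a => w k - a).prod := by
  set Q : Fin n → Polynomial ℝ := fun k => (((List.range k).map w ++ T k).map fun a =>
          (Polynomial.X - Polynomial.C a : Polynomial ℝ)).prod with hQ
  have hdeg : ∀ k, (Q k).natDegree < n := by
    intro k
    rw [hQ]
    simp only
    rw [natDegree_prod_X_sub_C_list, List.length_append, List.length_map, List.length_range]
    have := hT k
    omega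
  have heval : ∀ (k : Fin n) (z : ℝ), (Q k).eval z
      = ((List.range k).map fun i => z - w i).prod * ((T k).map fun a => z - a).prod := by
    intro k z
    rw [hQ]
    simp only
    rw [Polynomial.eval_list_prod]
    simp [List.map_map, Function.comp_def]
  have hmul : Matrix.vandermonde (fun i : Fin n => w i)
        * Matrix.of (fun j k : Fin n => (Q k).coeff j)
      = Matrix.of fun i k : Fin n => (Q k).eval (w i) := by
    ext i k
    rw [Matrix.mul_apply, Matrix.of_apply, Polynomial.eval_eq_sum_range' (hdeg k),
      Finset.sum_range]
    refine Finset.sum_congr rfl fun j _ => ?_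
    rw [Matrix.vandermonde_apply, Matrix.of_apply, mul_comm]
  have htri : Matrix.det (Matrix.of fun i k : Fin n => (Q k).eval (w i))
      = ∏ k : Fin n, (Q k).eval (w k) := by
    rw [Matrix.det_of_isLowerTriangular]
    · rfl
    · intro i k hik
      have hik' : (i : ℕ) < k := hik
      rw [Matrix.of_apply, heval]
      refine mul_eq_zero_of_left (List.prod_eq_zero ?_) _
      exact List.mem_map.2 ⟨i, List.mem_range.2 hik', sub_self _⟩
  have hV : (Matrix.vandermonde (fun i : Fin n => w i)).det
      = ∏ k : Fin n, ((List.range k).map fun i => w k - w i).prod := by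
    rw [Matrix.det_vandermonde, Finset.prod_comm' (t' := Finset.univ) (s' := fun k => Finset.Iio k)]
    · exact Finset.prod_congr rfl fun k _ => Fin.prod_Iio_val k fun i => w k - w i
    · intro i k; simp
  have hV0 : (Matrix.vandermonde (fun i : Fin n => w i)).det ≠ 0 :=
    Matrix.det_vandermonde_ne_zero_iff.2 fun i k h => Fin.ext (hw h)
  refine mul_left_cancel₀ hV0 ?_
  rw [← Matrix.det_mul, hmul, htri, hV, ← Finset.prod_mul_distrib]
  exact Finset.prod_congr rfl fun k _ => heval k _

/-- A variant of the Jacobi–Trudi identity, in which the variables `w_0, …, w_{k-1}` and `T_k`,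
`n - 1` altogether, are left out in the `k`-th column. -/
theorem prod_mul_schurFunction_eq_det {n : ℕ} {y : List ℝ} {w : ℕ → ℝ}
    (hw : Function.Injective w) {T l : Fin n → List ℝ}
    (hT : ∀ k : Fin n, (k : ℕ) + (T k).length + 1 = n)
    (hp : ∀ k : Fin n, ((List.range k).map w ++ T k ++ l k).Perm y)
    {μ : YoungDiagram} (hμ : μ.colLen 0 ≤ n) :
    (∏ k : Fin n, ((T k).map fun a => w k - a).prod) * schurFunction μ y
      = Matrix.det (Matrix.of fun i k : Fin n =>
          completeHomogeneous (l k) ((μ.rowLen i : ℤ) - (i : ℕ) + n - 1)) := by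
  rw [schurFunction_eq_det y μ hμ, ← det_coeff_prod_X_sub_C w hw T hT, mul_comm,
    ← Matrix.det_mul]
  congr 1
  ext i k
  rw [Matrix.mul_apply, Matrix.of_apply, ← sum_coeff_mul_completeHomogeneous (n := n) _ (hp k)]
  · rfl
  · have := hT k
    simp only [List.length_append, List.length_map, List.length_range]
    omega

/-! ### Integrals over a Hankel contour -/

section

open Complex Set MeasureTheory Filter Topology

/-- `(2πi)⁻¹ ∫ f` over the contour that runs from `-∞ - i` to `c - i`, to `c + i`, and back to
`-∞ + i`; the two horizontal rays are integrated together. -/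
noncomputable def hankelIntegral (c : ℝ) (f : ℂ → ℂ) : ℂ :=
  (2 * (Real.pi : ℂ) * I)⁻¹ *
    ((∫ t in Iic c, (f ((t : ℂ) - I) - f ((t : ℂ) + I)))
      + I * ∫ t in (-1 : ℝ)..1, f ((c : ℂ) + (t : ℂ) * I))

/-- The rational function `∏_{a ∈ l} (a + s)⁻¹`. -/
noncomputable def prodInvAdd (l : List ℝ) (s : ℂ) : ℂ :=
  (l.map fun a : ℝ => ((a : ℂ) + s)⁻¹).prod

/-- The inverse Mellin transform `(2πi)⁻¹ ∮ e^{us} ∏_{a ∈ l} (a + s)⁻¹ ds`, in the logarithmic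
variable `u`. It is of interest for `u ≥ 0`; at `u = 0` the rays converge, when taken together, as
soon as `l` is not empty. -/
noncomputable def hankelKernel (c : ℝ) (l : List ℝ) (u : ℝ) : ℂ :=
  hankelIntegral c fun s => prodInvAdd l s * cexp (u * s)

/-- The difference of the values at `t - i` and `t + i` of the integrand of `hankelKernel`. -/
noncomputable def rayIntegrand (l : List ℝ) (u t : ℝ) : ℂ :=
  prodInvAdd l ((t : ℂ) - I) * cexp (u * ((t : ℂ) - I))
    - prodInvAdd l ((t : ℂ) + I) * cexp (u * ((t : ℂ) + I))

theorem ofReal_sub_I_mem_slitPlane (t : ℝ) : (t : ℂ) - I ∈ slitPlane := Or.inr (by simp)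

theorem ofReal_add_I_mem_slitPlane (t : ℝ) : (t : ℂ) + I ∈ slitPlane := Or.inr (by simp)

theorem ofReal_add_mul_I_mem_slitPlane {c : ℝ} (hc : 0 < c) (t : ℝ) :
    (c : ℂ) + (t : ℂ) * I ∈ slitPlane := Or.inl (by simpa using hc)

theorem hankelIntegral_congr {c : ℝ} (hc : 0 < c) {f g : ℂ → ℂ} (h : EqOn f g slitPlane) :
    hankelIntegral c f = hankelIntegral c g := by
  unfold hankelIntegral
  simp only [h (ofReal_sub_I_mem_slitPlane _), h (ofReal_add_I_mem_slitPlane _),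
    h (ofReal_add_mul_I_mem_slitPlane hc _)]

theorem continuous_comp_ofReal_sub_I {f : ℂ → ℂ} (hf : ContinuousOn f slitPlane) :
    Continuous fun t : ℝ => f ((t : ℂ) - I) :=
  hf.comp_continuous (by fun_prop) ofReal_sub_I_mem_slitPlane

theorem continuous_comp_ofReal_add_I {f : ℂ → ℂ} (hf : ContinuousOn f slitPlane) :
    Continuous fun t : ℝ => f ((t : ℂ) + I) :=
  hf.comp_continuous (by fun_prop) ofReal_add_I_mem_slitPlane

theorem continuous_comp_ofReal_add_mul_I {c : ℝ} (hc : 0 < c) {f : ℂ → ℂ}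
    (hf : ContinuousOn f slitPlane) : Continuous fun t : ℝ => f ((c : ℂ) + (t : ℂ) * I) :=
  hf.comp_continuous (by fun_prop) (ofReal_add_mul_I_mem_slitPlane hc)

/-- The contour integral of a derivative vanishes if the boundary terms at `-∞ ± i` cancel. -/
theorem hankelIntegral_eq_zero_of_hasDerivAt {c : ℝ} (hc : 0 < c) {F f : ℂ → ℂ}
    (hF : ∀ s ∈ slitPlane, HasDerivAt F (f s) s) (hf : ContinuousOn f slitPlane)
    (hint : IntegrableOn (fun t : ℝ => f ((t : ℂ) - I) - f ((t : ℂ) + I)) (Iic c))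
    (hlim : Tendsto (fun t : ℝ => F ((t : ℂ) - I) - F ((t : ℂ) + I)) atBot (𝓝 0)) :
    hankelIntegral c f = 0 := by
  have h1 : ∫ t in Iic c, (f ((t : ℂ) - I) - f ((t : ℂ) + I))
      = F ((c : ℂ) - I) - F ((c : ℂ) + I) := by
    have := integral_Iic_of_hasDerivAt_of_tendsto' (a := c) (m := 0)
      (f := fun t : ℝ => F ((t : ℂ) - I) - F ((t : ℂ) + I)) (fun t _ => ?_) hint hlim
    · simpa using this
    · refine HasDerivAt.sub ?_ ?_
      · have h := (hF _ (ofReal_sub_I_mem_slitPlane t)).scomp t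
          ((hasDerivAt_id t).ofReal_comp.sub_const I)
        simpa [Function.comp_def] using h
      · have h := (hF _ (ofReal_add_I_mem_slitPlane t)).scomp t
          ((hasDerivAt_id t).ofReal_comp.add_const I)
        simpa [Function.comp_def] using h
  have h2 : I * ∫ t in (-1 : ℝ)..1, f ((c : ℂ) + (t : ℂ) * I)
      = F ((c : ℂ) + I) - F ((c : ℂ) - I) := by
    rw [← intervalIntegral.integral_const_mul]
    rw [intervalIntegral.integral_eq_sub_of_hasDerivAt
      (f := fun t : ℝ => F ((c : ℂ) + (t : ℂ) * I))]
    · simp [sub_eq_add_neg]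
    · intro t _
      have h := (hF _ (ofReal_add_mul_I_mem_slitPlane hc t)).scomp t
        (((hasDerivAt_id t).ofReal_comp.mul_const I).const_add (c : ℂ))
      simpa [Function.comp_def, mul_comm] using h
    · exact (continuous_const.mul (continuous_comp_ofReal_add_mul_I hc hf)).intervalIntegrable _ _
  unfold hankelIntegral
  rw [h1, h2]
  ring

theorem ofReal_add_ne_zero {a : ℝ} (ha : 0 < a) {s : ℂ} (hs : s ∈ slitPlane) :
    (a : ℂ) + s ≠ 0 := by
  intro h
  have h1 : s = ((-a : ℝ) : ℂ) := by
    push_cast; exact eq_neg_of_add_eq_zero_right h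
  rw [h1, ofReal_mem_slitPlane] at hs
  linarith

theorem continuousOn_prodInvAdd {l : List ℝ} (hl : ∀ a ∈ l, 0 < a) :
    ContinuousOn (prodInvAdd l) slitPlane := by
  induction l with
  | nil => exact continuousOn_const
  | cons a l ih =>
    have h1 := ih fun b hb => hl b (List.mem_cons_of_mem _ hb)
    have h2 : ContinuousOn (fun s : ℂ => ((a : ℂ) + s)⁻¹) slitPlane :=
      ContinuousOn.inv₀ (by fun_prop) fun s hs => ofReal_add_ne_zero (hl a List.mem_cons_self) hs
    exact h2.mul h1

theorem prodInvAdd_cons (a : ℝ) (l : List ℝ) (s : ℂ) :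
    prodInvAdd (a :: l) s = ((a : ℂ) + s)⁻¹ * prodInvAdd l s := rfl

theorem norm_inv_add_le_one (a : ℝ) {s : ℂ} (hs : |s.im| = 1) : ‖((a : ℂ) + s)⁻¹‖ ≤ 1 := by
  rw [norm_inv]
  refine inv_le_one_of_one_le₀ ?_
  have := abs_im_le_norm ((a : ℂ) + s)
  simpa [hs] using this

theorem norm_prodInvAdd_le_one (l : List ℝ) {s : ℂ} (hs : |s.im| = 1) :
    ‖prodInvAdd l s‖ ≤ 1 := by
  induction l with
  | nil => simp [prodInvAdd]
  | cons a l ih =>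
    rw [prodInvAdd_cons, norm_mul]
    exact mul_le_one₀ (norm_inv_add_le_one a hs) (norm_nonneg _) ih

theorem inv_add_sub_inv_add (a t : ℝ) :
    ((a : ℂ) + ((t : ℂ) - I))⁻¹ - ((a : ℂ) + ((t : ℂ) + I))⁻¹
      = ((2 * (1 + (t + a) ^ 2)⁻¹ : ℝ) : ℂ) * I := by
  have h1 : (a : ℂ) + ((t : ℂ) - I) ≠ 0 := by
    intro h; simpa using congrArg Complex.im h
  have h2 : (a : ℂ) + ((t : ℂ) + I) ≠ 0 := by
    intro h; simpa using congrArg Complex.im h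
  have h3 : ((1 : ℂ) + ((t : ℂ) + a) ^ 2) ≠ 0 := by
    have : (1 + (t + a) ^ 2 : ℝ) ≠ 0 := by positivity
    exact_mod_cast this
  push_cast
  field_simp
  ring_nf
  simp only [show I ^ 3 = -I by rw [pow_succ, I_sq]; ring]
  ring

theorem inv_one_add_add_sq_le (a t : ℝ) :
    (1 + (t + a) ^ 2)⁻¹ ≤ (2 + 2 * a ^ 2) * (1 + t ^ 2)⁻¹ := by
  rw [← div_eq_mul_inv, inv_eq_one_div, div_le_div_iff₀ (by positivity) (by positivity)]
  nlinarith [sq_nonneg (t + 2 * a), sq_nonneg (a * (t + a)), sq_nonneg (t+a), sq_nonneg a]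

/-- On the two rays the values of a rational function `∏ (a + s)⁻¹` differ by `O(t⁻²)`, even
if each of them is only `O(t⁻¹)`. -/
theorem exists_norm_prodInvAdd_sub_le (l : List ℝ) : ∃ K : ℝ, 0 ≤ K ∧ ∀ t : ℝ,
    ‖prodInvAdd l ((t : ℂ) - I) - prodInvAdd l ((t : ℂ) + I)‖ ≤ K * (1 + t ^ 2)⁻¹ := by
  induction l with
  | nil => exact ⟨0, le_rfl, fun t => by simp [prodInvAdd]⟩
  | cons a l ih =>
    obtain ⟨K, hK, h⟩ := ih
    refine ⟨2 * (2 + 2 * a ^ 2) + K, by positivity, fun t => ?_⟩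
    have e : prodInvAdd (a :: l) ((t : ℂ) - I) - prodInvAdd (a :: l) ((t : ℂ) + I)
        = (((a : ℂ) + ((t : ℂ) - I))⁻¹ - ((a : ℂ) + ((t : ℂ) + I))⁻¹)
            * prodInvAdd l ((t : ℂ) - I)
          + ((a : ℂ) + ((t : ℂ) + I))⁻¹
            * (prodInvAdd l ((t : ℂ) - I) - prodInvAdd l ((t : ℂ) + I)) := by
      rw [prodInvAdd_cons, prodInvAdd_cons]; ring
    rw [e]
    refine (norm_add_le _ _).trans ?_
    rw [norm_mul, norm_mul, inv_add_sub_inv_add, add_mul]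
    refine add_le_add ?_ ?_
    · rw [norm_mul, norm_I, mul_one, norm_real, Real.norm_of_nonneg (by positivity)]
      refine (mul_le_of_le_one_right (by positivity)
        (norm_prodInvAdd_le_one l (by simp))).trans ?_
      rw [mul_assoc]
      exact mul_le_mul_of_nonneg_left (inv_one_add_add_sq_le a t) (by norm_num)
    · exact (mul_le_of_le_one_left (norm_nonneg _)
        (norm_inv_add_le_one a (by simp))).trans (h t)

/-- On the rays a nonempty product is `O(t⁻¹)`. -/
theorem abs_mul_norm_prodInvAdd_le (a : ℝ) (l : List ℝ) (t : ℝ) :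
    |t| * ‖prodInvAdd (a :: l) ((t : ℂ) + I)‖ ≤ 1 + |a| := by
  have h1 : ‖prodInvAdd (a :: l) ((t : ℂ) + I)‖ ≤ ‖((a : ℂ) + ((t : ℂ) + I))⁻¹‖ := by
    rw [prodInvAdd_cons, norm_mul]
    exact mul_le_of_le_one_right (norm_nonneg _) (norm_prodInvAdd_le_one l (by simp))
  set z : ℂ := (a : ℂ) + ((t : ℂ) + I) with hz
  have h2 : |a + t| ≤ ‖z‖ := by simpa [hz] using abs_re_le_norm z
  have h3 : 1 ≤ ‖z‖ := by simpa [hz] using abs_im_le_norm z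
  have h4 : |t| ≤ (1 + |a|) * ‖z‖ := by
    have : |t| ≤ |a + t| + |a| := by
      have := abs_sub (a + t) a
      simpa using this
    nlinarith [abs_nonneg a]
  calc _ ≤ |t| * ‖z⁻¹‖ := mul_le_mul_of_nonneg_left h1 (abs_nonneg _)
    _ ≤ 1 + |a| := by
      rw [norm_inv, ← div_eq_mul_inv, div_le_iff₀ (by linarith)]
      exact h4

end

/-! ### The differential equation of the kernels -/

section

open Complex Set MeasureTheory Filter Topology

theorem prodInvAdd_perm {l l' : List ℝ} (h : l.Perm l') : prodInvAdd l = prodInvAdd l' := by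
  funext s
  exact (h.map fun a : ℝ => ((a : ℂ) + s)⁻¹).prod_eq

theorem hankelKernel_perm {l l' : List ℝ} (h : l.Perm l') (c : ℝ) :
    hankelKernel c l = hankelKernel c l' := by
  funext u
  rw [hankelKernel, hankelKernel, prodInvAdd_perm h]

theorem continuousOn_prodInvAdd_mul_exp {l : List ℝ} (hl : ∀ a ∈ l, 0 < a) (u : ℝ) :
    ContinuousOn (fun s => prodInvAdd l s * cexp (u * s)) slitPlane :=
  (continuousOn_prodInvAdd hl).mul (by fun_prop)

theorem continuous_rayIntegrand {l : List ℝ} (hl : ∀ a ∈ l, 0 < a) (u : ℝ) :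
    Continuous (rayIntegrand l u) :=
  (continuous_comp_ofReal_sub_I (continuousOn_prodInvAdd_mul_exp hl u)).sub
    (continuous_comp_ofReal_add_I (continuousOn_prodInvAdd_mul_exp hl u))

theorem norm_cexp_mul_sub_I (u t : ℝ) : ‖cexp (u * ((t : ℂ) - I))‖ = Real.exp (u * t) := by
  rw [norm_exp]; simp

theorem norm_cexp_mul_add_I (u t : ℝ) : ‖cexp (u * ((t : ℂ) + I))‖ = Real.exp (u * t) := by
  rw [norm_exp]; simp

theorem norm_rayIntegrand_le (l : List ℝ) (u t : ℝ) :
    ‖rayIntegrand l u t‖ ≤ 2 * Real.exp (u * t) := by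
  refine (norm_sub_le _ _).trans ?_
  rw [norm_mul, norm_mul, norm_cexp_mul_sub_I, norm_cexp_mul_add_I, two_mul]
  exact add_le_add
    (mul_le_of_le_one_left (Real.exp_pos _).le (norm_prodInvAdd_le_one l (by simp)))
    (mul_le_of_le_one_left (Real.exp_pos _).le (norm_prodInvAdd_le_one l (by simp)))

theorem integrableOn_rayIntegrand_of_pos {l : List ℝ} (hl : ∀ a ∈ l, 0 < a) {u : ℝ} (hu : 0 < u)
    (c : ℝ) : IntegrableOn (rayIntegrand l u) (Iic c) :=
  Integrable.mono' ((integrableOn_exp_mul_Iic hu c).const_mul 2)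
    (continuous_rayIntegrand hl u).aestronglyMeasurable
    (Eventually.of_forall fun t => norm_rayIntegrand_le l u t)

theorem cexp_mul_sub_I_sub (u t : ℝ) :
    cexp (u * ((t : ℂ) - I)) - cexp (u * ((t : ℂ) + I))
      = ((-2 * Real.exp (u * t) * Real.sin u : ℝ) : ℂ) * I := by
  rw [sub_eq_add_neg (t : ℂ) I, mul_add, mul_add, exp_add, exp_add, ← mul_sub]
  have h1 : cexp (u * -I) = Complex.cos u - Complex.sin u * I := by
    rw [mul_neg, ← neg_mul, exp_mul_I, Complex.cos_neg, Complex.sin_neg]; ring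
  rw [h1, exp_mul_I]
  push_cast
  ring

/-- A bound on the integrand over the rays that is uniform in `0 ≤ u ≤ 1`. The difference over the
two rays is split into a difference of rational functions, which is `O(t⁻²)`, and a difference of
exponentials, which gains a factor `u`; the latter makes up for the missing decay since
`u |t| e^{ut} ≤ 1` for `t ≤ 0`. -/
theorem exists_norm_rayIntegrand_le {c : ℝ} (hc : 0 < c) (a : ℝ) (l : List ℝ) :
    ∃ K : ℝ, ∀ u ∈ Icc (0 : ℝ) 1, ∀ t ≤ c,
      ‖rayIntegrand (a :: l) u t‖ ≤ K * (1 + t ^ 2)⁻¹ := by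
  obtain ⟨K, hK, h⟩ := exists_norm_prodInvAdd_sub_le (a :: l)
  refine ⟨Real.exp c * K + 2 * (Real.exp c * (1 + (1 + |a|) * (1 + c))), ?_⟩
  rintro u ⟨hu0, hu1⟩ t ht
  have he : Real.exp (u * t) ≤ Real.exp c := by
    apply Real.exp_le_exp.2
    rcases le_total t 0 with h0 | h0 <;> nlinarith
  have hte : |t| * (u * Real.exp (u * t)) ≤ Real.exp c * (1 + c) := by
    rcases le_total t 0 with h0 | h0
    · have h1 : u * |t| ≤ Real.exp (u * |t|) := by
        have := Real.add_one_le_exp (u * |t|); linarith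
      have h2 : u * t = -(u * |t|) := by rw [abs_of_nonpos h0]; ring
      have h3 : |t| * (u * Real.exp (u * t)) ≤ 1 := by
        rw [h2, Real.exp_neg, ← mul_assoc, mul_comm |t| u, ← div_eq_mul_inv,
          div_le_one (Real.exp_pos _)]
        exact h1
      have h4 : 1 ≤ Real.exp c := Real.one_le_exp hc.le
      nlinarith
    · rw [abs_of_nonneg h0]
      have h1 : t * (u * Real.exp (u * t)) ≤ c * (1 * Real.exp c) :=
        mul_le_mul ht (mul_le_mul hu1 he (Real.exp_pos _).le zero_le_one)
          (mul_nonneg hu0 (Real.exp_pos _).le) hc.le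
      have := Real.exp_pos c
      nlinarith
  have e : rayIntegrand (a :: l) u t
      = cexp (u * ((t : ℂ) - I))
          * (prodInvAdd (a :: l) ((t : ℂ) - I) - prodInvAdd (a :: l) ((t : ℂ) + I))
        + prodInvAdd (a :: l) ((t : ℂ) + I)
          * (cexp (u * ((t : ℂ) - I)) - cexp (u * ((t : ℂ) + I))) := by
    unfold rayIntegrand; ring
  rw [e]
  refine (norm_add_le _ _).trans ?_
  rw [norm_mul, norm_mul, norm_cexp_mul_sub_I, cexp_mul_sub_I_sub, add_mul]
  refine add_le_add ?_ ?_
  · rw [mul_assoc]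
    exact mul_le_mul he (h t) (norm_nonneg _) (Real.exp_pos _).le
  · set r := ‖prodInvAdd (a :: l) ((t : ℂ) + I)‖ with hr
    have hr1 : r ≤ 1 := norm_prodInvAdd_le_one _ (by simp)
    have hr2 : |t| * r ≤ 1 + |a| := abs_mul_norm_prodInvAdd_le a l t
    have hr0 : 0 ≤ r := norm_nonneg _
    rw [norm_mul, norm_I, mul_one, norm_real, Real.norm_eq_abs, abs_mul, abs_mul, Real.abs_exp]
    have hs : |Real.sin u| ≤ u := by
      have := Real.abs_sin_le_abs (x := u)
      rwa [abs_of_nonneg hu0] at this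
    rw [← div_eq_mul_inv, le_div_iff₀ (by positivity)]
    have hE := Real.exp_pos (u * t)
    have hA : r * (|(-2 : ℝ)| * Real.exp (u * t) * |Real.sin u|) * (1 + t ^ 2)
        ≤ r * (2 * Real.exp (u * t) * u) * (1 + t ^ 2) := by
      rw [abs_neg, abs_two]
      gcongr
    refine hA.trans ?_
    have hB : r * (2 * Real.exp (u * t) * u) * (1 + t ^ 2)
        = 2 * (r * (u * Real.exp (u * t)) + (|t| * r) * (|t| * (u * Real.exp (u * t)))) := by
      rw [← sq_abs t]; ring
    rw [hB]
    have hC : r * (u * Real.exp (u * t)) ≤ 1 * (1 * Real.exp c) := by gcongr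
    have hD : (|t| * r) * (|t| * (u * Real.exp (u * t))) ≤ (1 + |a|) * (Real.exp c * (1 + c)) := by
      gcongr
    nlinarith

theorem integrableOn_rayIntegrand_of_nonneg {c : ℝ} (hc : 0 < c) {a : ℝ} {l : List ℝ}
    (hl : ∀ b ∈ a :: l, 0 < b) {u : ℝ} (hu : 0 ≤ u) :
    IntegrableOn (rayIntegrand (a :: l) u) (Iic c) := by
  rcases hu.eq_or_lt with rfl | hu
  · obtain ⟨K, hK⟩ := exists_norm_rayIntegrand_le hc a l
    refine Integrable.mono' (integrable_inv_one_add_sq.integrableOn.const_mul K)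
      (continuous_rayIntegrand hl 0).aestronglyMeasurable ?_
    filter_upwards [ae_restrict_mem measurableSet_Iic] with t ht
    exact hK 0 (by simp) t ht
  · exact integrableOn_rayIntegrand_of_pos hl hu c

theorem hankelKernel_eq (c : ℝ) (l : List ℝ) (u : ℝ) :
    hankelKernel c l u = (2 * (Real.pi : ℂ) * I)⁻¹ * ((∫ t in Iic c, rayIntegrand l u t)
      + I * ∫ t in (-1 : ℝ)..1, prodInvAdd l ((c : ℂ) + (t : ℂ) * I)
          * cexp (u * ((c : ℂ) + (t : ℂ) * I))) := rfl

/-- The derivative of the contribution of the vertical segment. -/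
theorem hasDerivAt_integral_vertical {c : ℝ} (hc : 0 < c) {l : List ℝ} (hl : ∀ a ∈ l, 0 < a)
    (u : ℝ) :
    HasDerivAt (fun u : ℝ => ∫ t in (-1 : ℝ)..1, prodInvAdd l ((c : ℂ) + (t : ℂ) * I)
          * cexp (u * ((c : ℂ) + (t : ℂ) * I)))
      (∫ t in (-1 : ℝ)..1, ((c : ℂ) + (t : ℂ) * I) * (prodInvAdd l ((c : ℂ) + (t : ℂ) * I)
          * cexp (u * ((c : ℂ) + (t : ℂ) * I)))) u := by
  have hR := continuous_comp_ofReal_add_mul_I hc (continuousOn_prodInvAdd hl)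
  refine (intervalIntegral.hasDerivAt_integral_of_dominated_loc_of_deriv_le
    (F := fun (u t : ℝ) => prodInvAdd l ((c : ℂ) + (t : ℂ) * I)
          * cexp (u * ((c : ℂ) + (t : ℂ) * I)))
    (F' := fun (u t : ℝ) => ((c : ℂ) + (t : ℂ) * I) * (prodInvAdd l ((c : ℂ) + (t : ℂ) * I)
          * cexp (u * ((c : ℂ) + (t : ℂ) * I))))
    (bound := fun t => ‖((c : ℂ) + (t : ℂ) * I)‖ * (‖prodInvAdd l ((c : ℂ) + (t : ℂ) * I)‖
          * Real.exp ((u + 1) * c)))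
    (s := Iio (u + 1)) (Iio_mem_nhds (by linarith)) ?_ ?_ ?_ ?_ ?_ ?_).2
  · exact Eventually.of_forall fun x =>
      (hR.mul (by fun_prop)).aestronglyMeasurable
  · exact (hR.mul (by fun_prop)).intervalIntegrable _ _
  · exact (Continuous.mul (by fun_prop) (hR.mul (by fun_prop))).aestronglyMeasurable
  · refine Eventually.of_forall fun t _ x hx => ?_
    rw [norm_mul, norm_mul, norm_exp]
    gcongr
    have : ((x : ℂ) * ((c : ℂ) + (t : ℂ) * I)).re = x * c := by simp
    rw [this]
    exact mul_le_mul_of_nonneg_right (le_of_lt hx) hc.le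
  · exact (Continuous.mul (by fun_prop) (hR.norm.mul continuous_const)).intervalIntegrable _ _
  · refine Eventually.of_forall fun t _ x _ => ?_
    have h1 : HasDerivAt (fun x : ℝ => (x : ℂ) * ((c : ℂ) + (t : ℂ) * I))
        ((c : ℂ) + (t : ℂ) * I) x := by
      simpa using (hasDerivAt_id x).ofReal_comp.mul_const ((c : ℂ) + (t : ℂ) * I)
    refine (h1.cexp.const_mul (prodInvAdd l ((c : ℂ) + (t : ℂ) * I))).congr_deriv ?_
    ring

/-- Right continuity at `u = 0`, by dominated convergence. It is what carries the differential
equation, valid for `u > 0`, to initial values at `0`. -/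
theorem continuousWithinAt_hankelKernel_zero {c : ℝ} (hc : 0 < c) {a : ℝ} {l : List ℝ}
    (hl : ∀ b ∈ a :: l, 0 < b) :
    ContinuousWithinAt (hankelKernel c (a :: l)) (Ici 0) 0 := by
  obtain ⟨K, hK⟩ := exists_norm_rayIntegrand_le hc a l
  have h1 : ContinuousWithinAt (fun u : ℝ => ∫ t in Iic c, rayIntegrand (a :: l) u t)
      (Ici 0) 0 := by
    refine continuousWithinAt_of_dominated (bound := fun t => K * (1 + t ^ 2)⁻¹) ?_ ?_ ?_ ?_
    · exact Eventually.of_forall fun u => (continuous_rayIntegrand hl u).aestronglyMeasurable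
    · have h0 : Icc (0 : ℝ) 1 ∈ 𝓝[≥] 0 := Icc_mem_nhdsGE zero_lt_one
      filter_upwards [h0] with u hu
      filter_upwards [ae_restrict_mem measurableSet_Iic] with t ht
      exact hK u hu t ht
    · exact integrable_inv_one_add_sq.integrableOn.const_mul K
    · refine Eventually.of_forall fun t => Continuous.continuousWithinAt ?_
      unfold rayIntegrand
      fun_prop
  have h2 := (hasDerivAt_integral_vertical hc hl 0).continuousAt.continuousWithinAt (s := Ici 0)
  exact (h1.add (h2.const_mul I)).const_mul _

/-- The majorant for differentiating under the integral over the rays. -/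
theorem exists_abs_add_one_mul_exp_le {u c : ℝ} (hu : 0 < u) (hc : 0 < c) :
    ∃ K : ℝ, ∀ x ∈ Ioo (u / 2) (2 * u), ∀ t ≤ c,
      (|t| + 1) * Real.exp (x * t) ≤ K * Real.exp (u / 4 * t) := by
  refine ⟨4 / u + (c + 1) * Real.exp (2 * u * c) + 1, ?_⟩
  rintro x ⟨hx1, hx2⟩ t ht
  have hE := Real.exp_pos (2 * u * c)
  have h4u : 0 < 4 / u := by positivity
  have key : (|t| + 1) * Real.exp ((x - u / 4) * t)
      ≤ 4 / u + (c + 1) * Real.exp (2 * u * c) + 1 := by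
    rcases le_total t 0 with h0 | h0
    · have h1 : Real.exp ((x - u / 4) * t) ≤ Real.exp (u / 4 * t) := by
        apply Real.exp_le_exp.2; nlinarith
      have h2 : Real.exp (u / 4 * t) ≤ 1 := Real.exp_le_one_iff.2 (by nlinarith)
      have h3 : |t| * Real.exp (u / 4 * t) ≤ 4 / u := by
        have h5 : u / 4 * |t| ≤ Real.exp (u / 4 * |t|) := by
          have := Real.add_one_le_exp (u / 4 * |t|); linarith
        have h6 : u / 4 * t = -(u / 4 * |t|) := by rw [abs_of_nonpos h0]; ring
        rw [h6, Real.exp_neg, ← div_eq_mul_inv, div_le_div_iff₀ (Real.exp_pos _) hu]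
        nlinarith
      have : (|t| + 1) * Real.exp ((x - u / 4) * t) ≤ (|t| + 1) * Real.exp (u / 4 * t) := by
        gcongr
      nlinarith
    · rw [abs_of_nonneg h0]
      have h1 : Real.exp ((x - u / 4) * t) ≤ Real.exp (2 * u * c) := by
        apply Real.exp_le_exp.2
        have : (x - u / 4) ≤ 2 * u := by linarith
        nlinarith
      have : (t + 1) * Real.exp ((x - u / 4) * t) ≤ (c + 1) * Real.exp (2 * u * c) := by
        gcongr
      linarith
  have e : Real.exp (x * t) = Real.exp ((x - u / 4) * t) * Real.exp (u / 4 * t) := by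
    rw [← Real.exp_add]; congr 1; ring
  rw [e, ← mul_assoc]
  exact mul_le_mul_of_nonneg_right key (Real.exp_pos _).le

/-- The derivative of the contribution of the two rays. -/
theorem hasDerivAt_integral_ray {c : ℝ} (hc : 0 < c) {l : List ℝ} (hl : ∀ a ∈ l, 0 < a)
    {u : ℝ} (hu : 0 < u) :
    HasDerivAt (fun u : ℝ => ∫ t in Iic c, rayIntegrand l u t)
      (∫ t in Iic c, (((t : ℂ) - I) * (prodInvAdd l ((t : ℂ) - I) * cexp (u * ((t : ℂ) - I)))
        - ((t : ℂ) + I) * (prodInvAdd l ((t : ℂ) + I) * cexp (u * ((t : ℂ) + I))))) u := by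
  obtain ⟨K, hK⟩ := exists_abs_add_one_mul_exp_le hu hc
  have hR1 := continuous_comp_ofReal_sub_I (continuousOn_prodInvAdd hl)
  have hR2 := continuous_comp_ofReal_add_I (continuousOn_prodInvAdd hl)
  refine (hasDerivAt_integral_of_dominated_loc_of_deriv_le
    (F := rayIntegrand l)
    (F' := fun (u t : ℝ) => ((t : ℂ) - I) * (prodInvAdd l ((t : ℂ) - I) * cexp (u * ((t : ℂ) - I)))
        - ((t : ℂ) + I) * (prodInvAdd l ((t : ℂ) + I) * cexp (u * ((t : ℂ) + I))))
    (bound := fun t => 2 * (K * Real.exp (u / 4 * t)))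
    (s := Ioo (u / 2) (2 * u)) (Ioo_mem_nhds (by linarith) (by linarith)) ?_ ?_ ?_ ?_ ?_ ?_).2
  · exact Eventually.of_forall fun x => (continuous_rayIntegrand hl x).aestronglyMeasurable
  · exact integrableOn_rayIntegrand_of_pos hl hu c
  · exact Continuous.aestronglyMeasurable
      ((Continuous.mul (by fun_prop) (hR1.mul (by fun_prop))).sub
        (Continuous.mul (by fun_prop) (hR2.mul (by fun_prop))))
  · filter_upwards [ae_restrict_mem measurableSet_Iic] with t ht x hx
    refine (norm_sub_le _ _).trans ?_
    rw [norm_mul, norm_mul, norm_mul, norm_mul, norm_cexp_mul_sub_I, norm_cexp_mul_add_I, two_mul]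
    have h1 : ‖(t : ℂ) - I‖ ≤ |t| + 1 := by simpa using norm_sub_le (t : ℂ) I
    have h2 : ‖(t : ℂ) + I‖ ≤ |t| + 1 := by simpa using norm_add_le (t : ℂ) I
    have h3 : ‖prodInvAdd l ((t : ℂ) - I)‖ * Real.exp (x * t) ≤ Real.exp (x * t) :=
      mul_le_of_le_one_left (Real.exp_pos _).le (norm_prodInvAdd_le_one l (by simp))
    have h4 : ‖prodInvAdd l ((t : ℂ) + I)‖ * Real.exp (x * t) ≤ Real.exp (x * t) :=
      mul_le_of_le_one_left (Real.exp_pos _).le (norm_prodInvAdd_le_one l (by simp))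
    exact add_le_add ((by gcongr : _ ≤ (|t| + 1) * Real.exp (x * t)).trans (hK x hx t ht))
      ((by gcongr : _ ≤ (|t| + 1) * Real.exp (x * t)).trans (hK x hx t ht))
  · exact ((integrableOn_exp_mul_Iic (by linarith : 0 < u / 4) c).const_mul K).const_mul 2
  · refine Eventually.of_forall fun t x _ => ?_
    have h1 : ∀ z : ℂ, HasDerivAt (fun x : ℝ => (x : ℂ) * z) z x := fun z => by
      simpa using (hasDerivAt_id x).ofReal_comp.mul_const z
    refine (((h1 _).cexp.const_mul (prodInvAdd l ((t : ℂ) - I))).sub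
      ((h1 _).cexp.const_mul (prodInvAdd l ((t : ℂ) + I)))).congr_deriv ?_
    ring

theorem hankelIntegral_sub_const_mul {c : ℝ} (hc : 0 < c) {f g : ℂ → ℂ}
    (hf : ContinuousOn f slitPlane) (hg : ContinuousOn g slitPlane)
    (hfi : IntegrableOn (fun t : ℝ => f ((t : ℂ) - I) - f ((t : ℂ) + I)) (Iic c))
    (hgi : IntegrableOn (fun t : ℝ => g ((t : ℂ) - I) - g ((t : ℂ) + I)) (Iic c)) (a : ℂ) :
    hankelIntegral c (fun s => f s - a * g s) = hankelIntegral c f - a * hankelIntegral c g := by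
  unfold hankelIntegral
  have h1 : ∫ t in Iic c, (f ((t : ℂ) - I) - a * g ((t : ℂ) - I)
        - (f ((t : ℂ) + I) - a * g ((t : ℂ) + I)))
      = (∫ t in Iic c, (f ((t : ℂ) - I) - f ((t : ℂ) + I)))
        - a * ∫ t in Iic c, (g ((t : ℂ) - I) - g ((t : ℂ) + I)) := by
    rw [← integral_const_mul, ← integral_sub hfi (hgi.const_mul a)]
    congr 1
    funext t
    ring
  have h2 : ∫ t in (-1 : ℝ)..1, (f ((c : ℂ) + (t : ℂ) * I) - a * g ((c : ℂ) + (t : ℂ) * I))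
      = (∫ t in (-1 : ℝ)..1, f ((c : ℂ) + (t : ℂ) * I))
        - a * ∫ t in (-1 : ℝ)..1, g ((c : ℂ) + (t : ℂ) * I) := by
    rw [← intervalIntegral.integral_const_mul, ← intervalIntegral.integral_sub]
    · exact (continuous_comp_ofReal_add_mul_I hc hf).intervalIntegrable _ _
    · exact ((continuous_comp_ofReal_add_mul_I hc hg).const_mul a).intervalIntegrable _ _
  rw [h1, h2]
  ring

/-- The kernels satisfy the differential equations of the iterated convolutions of the
exponentials `e^{-au}`. -/
theorem hasDerivAt_hankelKernel_cons {c : ℝ} (hc : 0 < c) {a : ℝ} {l : List ℝ}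
    (hl : ∀ b ∈ a :: l, 0 < b) {u : ℝ} (hu : 0 < u) :
    HasDerivAt (hankelKernel c (a :: l))
      (hankelKernel c l u - a * hankelKernel c (a :: l) u) u := by
  have hl' : ∀ b ∈ l, 0 < b := fun b hb => hl b (List.mem_cons_of_mem _ hb)
  have h1 : HasDerivAt (hankelKernel c (a :: l))
      (hankelIntegral c fun s => s * (prodInvAdd (a :: l) s * cexp (u * s))) u :=
    ((hasDerivAt_integral_ray hc hl hu).add
      ((hasDerivAt_integral_vertical hc hl u).const_mul I)).const_mul _
  refine h1.congr_deriv ?_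
  rw [hankelKernel, hankelKernel, ← hankelIntegral_sub_const_mul hc
    (continuousOn_prodInvAdd_mul_exp hl' u) (continuousOn_prodInvAdd_mul_exp hl u)
    (integrableOn_rayIntegrand_of_pos hl' hu c) (integrableOn_rayIntegrand_of_pos hl hu c)]
  refine hankelIntegral_congr hc fun s hs => ?_
  have h0 := ofReal_add_ne_zero (hl a List.mem_cons_self) hs
  simp only [prodInvAdd_cons]
  field_simp
  ring

end

/-! ### Values of the kernels at the origin -/

section

open Complex Set MeasureTheory Filter Topology

/-- A mean value inequality that needs the derivative in the interior only. -/
theorem norm_sub_le_of_hasDerivAt_Ioo {f f' : ℝ → ℂ} {B B' : ℝ → ℝ} {a b : ℝ} (hab : a ≤ b)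
    (hf : ContinuousOn f (Icc a b)) (hf' : ∀ x ∈ Ioo a b, HasDerivAt f (f' x) x)
    (hB : ∀ x, HasDerivAt B (B' x) x) (hle : ∀ x ∈ Ioo a b, ‖f' x‖ ≤ B' x) :
    ‖f b - f a‖ ≤ B b - B a := by
  rcases hab.eq_or_lt with rfl | hab
  · simp
  have h1 : ∀ x ∈ Ioo a b, ‖f b - f x‖ ≤ B b - B x := by
    intro x hx
    refine image_norm_le_of_norm_deriv_right_le_deriv_boundary (f := fun y => f y - f x)
      (B := fun y => B y - B x) (f' := f') (B' := B') (a := x) (b := b)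
      ((hf.mono (Icc_subset_Icc_left hx.1.le)).sub continuousOn_const) (fun y hy => ?_) (by simp)
      (fun y => (hB y).sub_const _) (fun y hy => ?_) ⟨hx.2.le, le_rfl⟩
    · exact ((hf' y ⟨hx.1.trans_le hy.1, hy.2⟩).sub_const _).hasDerivWithinAt
    · exact hle y ⟨hx.1.trans_le hy.1, hy.2⟩
  have h2 : Tendsto f (𝓝[>] a) (𝓝 (f a)) :=
    ((hf a ⟨le_rfl, hab.le⟩).mono_of_mem_nhdsWithin (Icc_mem_nhdsGT hab)).tendsto
  have h3 : Tendsto (fun x : ℝ => B b - B x) (𝓝[>] a) (𝓝 (B b - B a)) :=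
    ((hB a).continuousAt.tendsto.mono_left nhdsWithin_le_nhds).const_sub _
  refine le_of_tendsto_of_tendsto (h2.const_sub (f b)).norm h3 ?_
  filter_upwards [Ioo_mem_nhdsGT hab] with x hx
  exact h1 x hx

theorem continuousOn_hankelKernel {c : ℝ} (hc : 0 < c) {a : ℝ} {l : List ℝ}
    (hl : ∀ b ∈ a :: l, 0 < b) : ContinuousOn (hankelKernel c (a :: l)) (Ici 0) := by
  intro x hx
  rcases (mem_Ici.1 hx).eq_or_lt with rfl | h0
  · exact continuousWithinAt_hankelKernel_zero hc hl
  · exact (hasDerivAt_hankelKernel_cons hc hl h0).continuousAt.continuousWithinAt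

/-- Without poles the kernel vanishes for `u > 0`: `e^{us} / u` is an antiderivative that tends to
`0` along the rays. -/
theorem hankelKernel_nil {c : ℝ} (hc : 0 < c) {u : ℝ} (hu : 0 < u) : hankelKernel c [] u = 0 := by
  have hu' : (u : ℂ) ≠ 0 := ofReal_ne_zero.2 hu.ne'
  refine hankelIntegral_eq_zero_of_hasDerivAt hc (F := fun s => cexp (u * s) / u) ?_
    (continuousOn_prodInvAdd_mul_exp (by simp) u)
    (integrableOn_rayIntegrand_of_pos (by simp) hu c) ?_
  · intro s _
    have h1 : HasDerivAt (fun s : ℂ => (u : ℂ) * s) u s := by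
      simpa using (hasDerivAt_id s).const_mul (u : ℂ)
    refine (h1.cexp.div_const (u : ℂ)).congr_deriv ?_
    simp [prodInvAdd, hu']
  · have h0 : Tendsto (fun t : ℝ => Real.exp (u * t)) atBot (𝓝 0) :=
      Real.tendsto_exp_atBot.comp (tendsto_id.const_mul_atBot hu)
    have h1 : Tendsto (fun t : ℝ => cexp (u * ((t : ℂ) - I))) atBot (𝓝 0) := by
      rw [tendsto_zero_iff_norm_tendsto_zero]
      simpa only [norm_cexp_mul_sub_I] using h0
    have h2 : Tendsto (fun t : ℝ => cexp (u * ((t : ℂ) + I))) atBot (𝓝 0) := by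
      rw [tendsto_zero_iff_norm_tendsto_zero]
      simpa only [norm_cexp_mul_add_I] using h0
    simpa using (h1.div_const (u : ℂ)).sub (h2.div_const (u : ℂ))

/-- At `u = 0` the kernel of a single exponential is `1`: the contour integral is an arctangent. -/
theorem hankelKernel_singleton_zero {c : ℝ} (hc : 0 < c) {a : ℝ} (ha : 0 < a) :
    hankelKernel c [a] 0 = 1 := by
  have hray : ∫ t in Iic c, rayIntegrand [a] 0 t
      = ((2 * (Real.arctan (c + a) + Real.pi / 2) : ℝ) : ℂ) * I := by
    have h1 : ∀ t : ℝ, rayIntegrand [a] 0 t = ((2 * (1 + (t + a) ^ 2)⁻¹ : ℝ) : ℂ) * I := by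
      intro t
      rw [← inv_add_sub_inv_add]
      simp [rayIntegrand, prodInvAdd]
    have h2 : ∫ t in Iic c, (2 * (1 + (t + a) ^ 2)⁻¹ : ℝ)
        = 2 * (Real.arctan (c + a) + Real.pi / 2) := by
      have h := integral_Iic_of_hasDerivAt_of_tendsto' (a := c)
        (f := fun t : ℝ => Real.arctan (t + a)) (f' := fun t : ℝ => (1 + (t + a) ^ 2)⁻¹)
        (m := -(Real.pi / 2))
        (fun t _ => (Real.hasDerivAt_arctan' (t + a)).comp_add_const t a)
        (integrable_inv_one_add_sq.comp_add_right a).integrableOn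
        ((tendsto_nhds_of_tendsto_nhdsWithin Real.tendsto_arctan_atBot).comp
          (tendsto_atBot_add_const_right _ a tendsto_id))
      rw [integral_const_mul, h, sub_neg_eq_add]
    simp only [h1]
    rw [integral_mul_const, integral_complex_ofReal, h2]
  set x := c + a with hx
  have hx0 : 0 < x := by positivity
  have hvert : ∫ t in (-1 : ℝ)..1, prodInvAdd [a] ((c : ℂ) + (t : ℂ) * I)
          * cexp ((0 : ℝ) * ((c : ℂ) + (t : ℂ) * I)) = ((2 * Real.arctan x⁻¹ : ℝ) : ℂ) := by
    -- An antiderivative of `(x + i t)⁻¹ = (x - i t) / (x² + t²)` in real terms.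
    have hd : ∀ t ∈ uIcc (-1 : ℝ) 1, HasDerivAt
        (fun t : ℝ => ((Real.arctan (t / x) : ℝ) : ℂ)
          - ((Real.log (x ^ 2 + t ^ 2) / 2 : ℝ) : ℂ) * I)
        (prodInvAdd [a] ((c : ℂ) + (t : ℂ) * I)
          * cexp ((0 : ℝ) * ((c : ℂ) + (t : ℂ) * I))) t := by
      intro t _
      have hpos : (x ^ 2 + t ^ 2) ≠ 0 := by positivity
      have d1 : HasDerivAt (fun t : ℝ => Real.arctan (t / x)) (x / (x ^ 2 + t ^ 2)) t := by
        refine (((hasDerivAt_id t).div_const x).arctan).congr_deriv ?_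
        simp only [id]
        field_simp
      have d2 : HasDerivAt (fun t : ℝ => Real.log (x ^ 2 + t ^ 2) / 2) (t / (x ^ 2 + t ^ 2)) t := by
        have := (((hasDerivAt_pow 2 t).const_add (x ^ 2)).log hpos).div_const 2
        refine this.congr_deriv ?_
        field_simp
        norm_num [mul_comm]
      refine (d1.ofReal_comp.sub (d2.ofReal_comp.mul_const I)).congr_deriv ?_
      have h3 : ((x : ℂ) ^ 2 + (t : ℂ) ^ 2) ≠ 0 := by exact_mod_cast hpos
      have h4 : (x : ℂ) + t * I ≠ 0 := by
        intro h
        have := congrArg Complex.re h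
        simp at this
        exact hx0.ne' this
      have h5 : prodInvAdd [a] ((c : ℂ) + (t : ℂ) * I)
          * cexp ((0 : ℝ) * ((c : ℂ) + (t : ℂ) * I)) = ((x : ℂ) + t * I)⁻¹ := by
        simp [prodInvAdd, hx]
        ring
      rw [h5]
      push_cast
      field_simp
      ring_nf
      rw [I_sq]
      ring
    rw [intervalIntegral.integral_eq_sub_of_hasDerivAt hd]
    · have h6 : Real.arctan (-1 / x) = - Real.arctan x⁻¹ := by
        rw [← Real.arctan_neg]; congr 1; ring
      rw [h6, one_div]
      push_cast
      ring_nf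
    · refine Continuous.intervalIntegrable ?_ _ _
      exact continuous_comp_ofReal_add_mul_I hc
        (continuousOn_prodInvAdd_mul_exp (l := [a]) (by simpa using ha) 0)
  rw [hankelKernel_eq, hray, hvert, Real.arctan_inv_of_pos hx0]
  have hpi : (Real.pi : ℂ) ≠ 0 := ofReal_ne_zero.2 Real.pi_ne_zero
  push_cast
  field_simp
  ring

/-- For `u > 0` the derivative of `e^{au}` times the kernel is zero; the constant is its value at
`u = 0`. -/
theorem hankelKernel_singleton {c : ℝ} (hc : 0 < c) {a : ℝ} (ha : 0 < a) {u : ℝ} (hu : 0 ≤ u) :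
    hankelKernel c [a] u = (Real.exp (-(a * u)) : ℂ) := by
  have hl : ∀ b ∈ [a], 0 < b := by simpa using ha
  have hexp : ∀ x : ℝ, HasDerivAt (fun x : ℝ => cexp ((a * x : ℝ))) (a * cexp ((a * x : ℝ))) x := by
    intro x
    have h1 : HasDerivAt (fun x : ℝ => (((a * x : ℝ)) : ℂ)) a x := by
      simpa using ((hasDerivAt_id x).const_mul a).ofReal_comp
    refine h1.cexp.congr_deriv ?_
    ring
  have hconst : cexp ((a * u : ℝ)) * hankelKernel c [a] u = 1 := by
    have hd : ∀ x ∈ Ioo 0 u, HasDerivAt (fun x : ℝ => cexp ((a * x : ℝ)) * hankelKernel c [a] x)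
        0 x := by
      intro x hx
      refine ((hexp x).mul (hasDerivAt_hankelKernel_cons hc hl hx.1)).congr_deriv ?_
      rw [hankelKernel_nil hc hx.1]
      ring
    have hcont : ContinuousOn (fun x : ℝ => cexp ((a * x : ℝ)) * hankelKernel c [a] x)
        (Icc 0 u) :=
      ContinuousOn.mul (fun x _ => (hexp x).continuousAt.continuousWithinAt)
        ((continuousOn_hankelKernel hc hl).mono Icc_subset_Ici_self)
    have := norm_sub_le_of_hasDerivAt_Ioo (B := fun _ => 0) (B' := fun _ => 0) hu hcont hd
      (fun x => hasDerivAt_const x 0) (by simp)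
    rw [sub_zero, norm_le_zero_iff, sub_eq_zero] at this
    simpa [hankelKernel_singleton_zero hc ha] using this
  rw [Real.exp_neg, ofReal_inv, ofReal_exp]
  exact eq_inv_of_mul_eq_one_right hconst

/-- The two differential equations of the kernel with the factors `a` and `b`, one for each order of
the two, determine `a - b` times the kernel for `u > 0`; then `u → 0`. -/
theorem hankelKernel_sub_mul {c : ℝ} (hc : 0 < c) {a b : ℝ} {l : List ℝ}
    (hl : ∀ x ∈ a :: b :: l, 0 < x) :
    ((a : ℂ) - b) * hankelKernel c (a :: b :: l) 0
      = hankelKernel c (b :: l) 0 - hankelKernel c (a :: l) 0 := by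
  have hla : ∀ x ∈ a :: l, 0 < x := by
    simp only [List.mem_cons] at hl ⊢; exact fun x hx => hl x (by tauto)
  have hlb : ∀ x ∈ b :: l, 0 < x := by
    simp only [List.mem_cons] at hl ⊢; exact fun x hx => hl x (by tauto)
  have hl' : ∀ x ∈ b :: a :: l, 0 < x := by
    simp only [List.mem_cons] at hl ⊢; exact fun x hx => hl x (by tauto)
  have h1 : ∀ u ∈ Ioi (0 : ℝ), ((a : ℂ) - b) * hankelKernel c (a :: b :: l) u
      = hankelKernel c (b :: l) u - hankelKernel c (a :: l) u := by
    intro u hu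
    have d1 := hasDerivAt_hankelKernel_cons hc hl hu
    have d2 := hasDerivAt_hankelKernel_cons hc hl' hu
    rw [hankelKernel_perm (List.Perm.swap a b l)] at d2
    linear_combination d2.unique d1
  have t : ∀ {x : ℝ} {k : List ℝ}, (∀ b ∈ x :: k, 0 < b) →
      Tendsto (hankelKernel c (x :: k)) (𝓝[>] 0) (𝓝 (hankelKernel c (x :: k) 0)) := fun hk =>
    (continuousWithinAt_hankelKernel_zero hc hk).tendsto.mono_left
      (nhdsWithin_mono _ Ioi_subset_Ici_self)
  refine tendsto_nhds_unique_of_eventuallyEq ((t hl).const_mul _) ((t hlb).sub (t hla)) ?_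
  filter_upwards [self_mem_nhdsWithin] with u hu
  exact h1 u hu

theorem tendsto_inv_add_atBot (a : ℝ) (w : ℂ) :
    Tendsto (fun t : ℝ => ((a : ℂ) + ((t : ℂ) + w))⁻¹) atBot (𝓝 0) := by
  rw [tendsto_zero_iff_norm_tendsto_zero]
  simp only [norm_inv]
  refine tendsto_inv_atTop_zero.comp ?_
  refine tendsto_atTop_mono (f := fun t : ℝ => |a + (t + w.re)|) (fun t => ?_) ?_
  · simpa using abs_re_le_norm ((a : ℂ) + ((t : ℂ) + w))
  · exact tendsto_abs_atBot_atTop.comp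
      (tendsto_atBot_add_const_left _ _ (tendsto_atBot_add_const_right _ _ tendsto_id))

/-- The integrand `(a + s)⁻¹ ^ (N + 2)` has the antiderivative `-(a + s)⁻¹ ^ (N + 1) / (N + 1)`. -/
theorem hankelKernel_replicate_zero {c : ℝ} (hc : 0 < c) {a : ℝ} (ha : 0 < a) (N : ℕ) :
    hankelKernel c (List.replicate (N + 2) a) 0 = 0 := by
  have hl : ∀ b ∈ List.replicate (N + 2) a, 0 < b := fun b hb => by
    rw [List.eq_of_mem_replicate hb]; exact ha
  refine hankelIntegral_eq_zero_of_hasDerivAt hc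
    (F := fun s => -(((a : ℂ) + s)⁻¹ ^ (N + 1)) / (N + 1)) ?_
    (continuousOn_prodInvAdd_mul_exp hl 0)
    (integrableOn_rayIntegrand_of_nonneg hc hl le_rfl) ?_
  · intro s hs
    have h0 := ofReal_add_ne_zero ha hs
    have hN : ((N : ℂ) + 1) ≠ 0 := Nat.cast_add_one_ne_zero N
    have h1 : HasDerivAt (fun s : ℂ => ((a : ℂ) + s)⁻¹) (-1 / ((a : ℂ) + s) ^ 2) s :=
      ((hasDerivAt_id s).const_add (a : ℂ)).fun_inv h0
    refine ((h1.fun_pow (N + 1)).neg.div_const _).congr_deriv ?_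
    simp only [prodInvAdd, List.map_replicate, List.prod_replicate, ofReal_zero, zero_mul, exp_zero,
      mul_one, Nat.add_sub_cancel]
    push_cast
    simp only [inv_pow]
    field_simp
    ring
  · have h1 := tendsto_inv_add_atBot a (-I)
    have h2 := tendsto_inv_add_atBot a I
    have h3 := ((h1.pow (N + 1)).neg.div_const ((N : ℂ) + 1)).sub
      ((h2.pow (N + 1)).neg.div_const ((N : ℂ) + 1))
    simpa [sub_eq_add_neg] using h3

/-- The kernel of several factors vanishes at `u = 0`. If two of the parameters differ, the
differential equations express it through kernels with one factor less; if all agree, the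
integrand has an antiderivative. -/
theorem hankelKernel_zero {c : ℝ} (hc : 0 < c) {l : List ℝ} (hl : ∀ a ∈ l, 0 < a)
    (hlen : 2 ≤ l.length) : hankelKernel c l 0 = 0 := by
  obtain ⟨N, hN⟩ : ∃ N, l.length = N + 2 := ⟨l.length - 2, by omega⟩
  clear hlen
  induction N generalizing l with
  | zero =>
    obtain ⟨a, b, rfl⟩ := List.length_eq_two.1 hN
    have ha : 0 < a := hl a (by simp)
    have hb : 0 < b := hl b (by simp)
    by_cases hab : a = b
    · subst hab
      exact hankelKernel_replicate_zero hc ha 0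
    · have h := hankelKernel_sub_mul hc hl
      rw [hankelKernel_singleton_zero hc ha, hankelKernel_singleton_zero hc hb, sub_self] at h
      refine (mul_eq_zero.1 h).resolve_left (sub_ne_zero.2 ?_)
      exact_mod_cast hab
  | succ N ih =>
    obtain ⟨a, l, rfl⟩ := List.exists_of_length_succ _ hN
    by_cases hall : ∀ b ∈ l, b = a
    · have : a :: l = List.replicate (N + 1 + 2) a := by
        refine List.eq_replicate_iff.2 ⟨hN, ?_⟩
        intro b hb
        rcases List.mem_cons.1 hb with rfl | hb
        · rfl
        · exact hall b hb
      rw [this]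
      exact hankelKernel_replicate_zero hc (hl a List.mem_cons_self) _
    · push Not at hall
      obtain ⟨b, hb, hba⟩ := hall
      have hp : (a :: l).Perm (a :: b :: l.erase b) := (List.perm_cons_erase hb).cons a
      have hl' : ∀ x ∈ a :: b :: l.erase b, 0 < x := fun x hx => hl x (hp.mem_iff.2 hx)
      have hlen := hp.length_eq
      rw [hN] at hlen
      simp only [List.length_cons] at hlen
      rw [hankelKernel_perm hp]
      have h := hankelKernel_sub_mul hc hl'
      simp only [List.mem_cons] at hl'
      rw [ih (l := b :: l.erase b) (by
            simp only [List.mem_cons]; exact fun x hx => hl' x (by tauto))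
          (by simp only [List.length_cons]; omega),
        ih (l := a :: l.erase b) (by simp only [List.mem_cons]; exact fun x hx => hl' x (by tauto))
          (by simp only [List.length_cons]; omega), sub_self] at h
      refine (mul_eq_zero.1 h).resolve_left (sub_ne_zero.2 ?_)
      exact_mod_cast hba.symm

end

/-! ### Approximation of the kernels by complete homogeneous functions -/

section

open Set Filter Topology

theorem completeHomogeneous_singleton (a : ℝ) (r : ℕ) : completeHomogeneous [a] r = a ^ r := by
  induction r with
  | zero => exact completeHomogeneous_zero _
  | succ r ih =>
    push_cast
    rw [completeHomogeneous_cons, ih, completeHomogeneous_nil, if_neg (by omega), pow_succ']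
    ring

/-- A bounded right hand side gives a bounded solution of `G' = g - a G`, `G 0 = 0`. -/
theorem norm_hankelKernel_cons_le {c : ℝ} (hc : 0 < c) {a b C : ℝ} {l : List ℝ}
    (hl : ∀ x ∈ a :: b :: l, 1 ≤ x) (hC : ∀ u, 0 ≤ u → ‖hankelKernel c (b :: l) u‖ ≤ C)
    {u : ℝ} (hu : 0 ≤ u) : ‖hankelKernel c (a :: b :: l) u‖ ≤ C := by
  have hl0 : ∀ x ∈ a :: b :: l, 0 < x := fun x hx => zero_lt_one.trans_le (hl x hx)
  have ha : 1 ≤ a := hl a List.mem_cons_self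
  have hexp : ∀ x : ℝ, HasDerivAt (fun x : ℝ => Real.exp (a * x)) (a * Real.exp (a * x)) x := by
    intro x
    have h1 : HasDerivAt (fun x : ℝ => a * x) a x := by
      simpa using (hasDerivAt_id x).const_mul a
    exact h1.exp.congr_deriv (mul_comm _ _)
  have hC0 : 0 ≤ C := (norm_nonneg _).trans (hC 0 le_rfl)
  have h := norm_sub_le_of_hasDerivAt_Ioo (a := 0) (b := u)
    (f := fun x : ℝ => ((Real.exp (a * x) : ℝ) : ℂ) * hankelKernel c (a :: b :: l) x)
    (f' := fun x : ℝ => ((Real.exp (a * x) : ℝ) : ℂ) * hankelKernel c (b :: l) x)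
    (B := fun x => C * Real.exp (a * x)) (B' := fun x => C * (a * Real.exp (a * x))) hu
    (ContinuousOn.mul (fun x _ => (hexp x).ofReal_comp.continuousAt.continuousWithinAt)
        ((continuousOn_hankelKernel hc hl0).mono Icc_subset_Ici_self))
    (fun x hx => ((hexp x).ofReal_comp.mul
      (hasDerivAt_hankelKernel_cons hc hl0 hx.1)).congr_deriv (by push_cast; ring))
    (fun x => (hexp x).const_mul C)
    (fun x hx => by
      rw [norm_mul, Complex.norm_real, Real.norm_of_nonneg (Real.exp_pos _).le]
      have := hC x hx.1.le
      have hE := Real.exp_pos (a * x)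
      calc Real.exp (a * x) * ‖hankelKernel c (b :: l) x‖ ≤ Real.exp (a * x) * C := by gcongr
        _ ≤ C * (a * Real.exp (a * x)) := by nlinarith [mul_nonneg hC0 hE.le])
  simp only [hankelKernel_zero hc hl0 (by simp), mul_zero, sub_zero, norm_mul, Complex.norm_real,
    Real.norm_of_nonneg (Real.exp_pos _).le, Real.exp_zero, mul_one] at h
  have hE := Real.exp_pos (a * u)
  refine le_of_mul_le_mul_left (h.trans ?_) hE
  linarith

/-- A bounded right hand side gives a Lipschitz solution. -/
theorem norm_hankelKernel_cons_sub_le {c : ℝ} (hc : 0 < c) {a b C : ℝ} {l : List ℝ}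
    (hl : ∀ x ∈ a :: b :: l, 1 ≤ x) (hC : ∀ u, 0 ≤ u → ‖hankelKernel c (b :: l) u‖ ≤ C)
    {u v : ℝ} (hu : 0 ≤ u) (huv : u ≤ v) :
    ‖hankelKernel c (a :: b :: l) v - hankelKernel c (a :: b :: l) u‖ ≤ (1 + a) * C * (v - u) := by
  have hl0 : ∀ x ∈ a :: b :: l, 0 < x := fun x hx => zero_lt_one.trans_le (hl x hx)
  have ha : 0 < a := hl0 a List.mem_cons_self
  have h := norm_sub_le_of_hasDerivAt_Ioo (B := fun x => (1 + a) * C * x)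
    (B' := fun _ => (1 + a) * C) huv
    ((continuousOn_hankelKernel hc hl0).mono fun x hx => hu.trans hx.1)
    (fun x hx => hasDerivAt_hankelKernel_cons hc hl0 (hu.trans_lt hx.1))
    (fun x => by simpa using (hasDerivAt_id x).const_mul ((1 + a) * C))
    (fun x hx => by
      have hx0 : 0 ≤ x := hu.trans hx.1.le
      refine (norm_sub_le _ _).trans ?_
      rw [norm_mul, Complex.norm_real, Real.norm_of_nonneg ha.le, add_mul, one_mul]
      exact add_le_add (hC x hx0)
        (mul_le_mul_of_nonneg_left (norm_hankelKernel_cons_le hc hl hC hx0) ha.le))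
  rwa [mul_sub]

/-- One step of length `ε` of the discretization of `G' = g - a G`. -/
theorem norm_hankelKernel_step_le {c : ℝ} (hc : 0 < c) {a b C : ℝ} {l : List ℝ}
    (hl : ∀ x ∈ a :: b :: l, 1 ≤ x) (hC : ∀ u, 0 ≤ u → ‖hankelKernel c (b :: l) u‖ ≤ C)
    (hL : ∀ u v, 0 ≤ u → u ≤ v →
      ‖hankelKernel c (b :: l) v - hankelKernel c (b :: l) u‖ ≤ C * (v - u))
    {ε : ℝ} (hε : 0 < ε) (hε1 : ε ≤ 1) {u : ℝ} (hu : 0 ≤ u) :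
    ‖hankelKernel c (a :: b :: l) (u + ε) - ((Real.exp (-a * ε) : ℝ) : ℂ)
        * (ε * hankelKernel c (b :: l) (u + ε) + hankelKernel c (a :: b :: l) u)‖
      ≤ (a * Real.exp a + 1) * C * ε ^ 2 := by
  have hl0 : ∀ x ∈ a :: b :: l, 0 < x := fun x hx => zero_lt_one.trans_le (hl x hx)
  have ha : 0 < a := hl0 a List.mem_cons_self
  have hC0 : 0 ≤ C := (norm_nonneg _).trans (hC 0 le_rfl)
  set g := hankelKernel c (b :: l) with hg
  set G := hankelKernel c (a :: b :: l) with hG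
  have hexp : ∀ x : ℝ, HasDerivAt (fun x : ℝ => Real.exp (a * (x - u)))
      (a * Real.exp (a * (x - u))) x := by
    intro x
    have h1 : HasDerivAt (fun x : ℝ => a * (x - u)) a x := by
      simpa using ((hasDerivAt_id x).sub_const u).const_mul a
    exact h1.exp.congr_deriv (mul_comm _ _)
  have hlin : ∀ x : ℝ, HasDerivAt (fun x : ℝ => ((x - u : ℝ) : ℂ) * g (u + ε)) (g (u + ε)) x := by
    intro x
    simpa using (((hasDerivAt_id x).sub_const u).ofReal_comp).mul_const (g (u + ε))
  have h := norm_sub_le_of_hasDerivAt_Ioo (a := u) (b := u + ε)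
    (f := fun x : ℝ => ((Real.exp (a * (x - u)) : ℝ) : ℂ) * G x - ((x - u : ℝ) : ℂ) * g (u + ε))
    (f' := fun x : ℝ => ((Real.exp (a * (x - u)) : ℝ) : ℂ) * g x - g (u + ε))
    (B := fun x => (a * Real.exp a + 1) * C * ε * x)
    (B' := fun _ => (a * Real.exp a + 1) * C * ε) (by linarith)
    ((ContinuousOn.mul (fun x _ => (hexp x).ofReal_comp.continuousAt.continuousWithinAt)
        ((continuousOn_hankelKernel hc hl0).mono fun x hx => hu.trans hx.1)).sub
      fun x _ => (hlin x).continuousAt.continuousWithinAt)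
    (fun x hx => (((hexp x).ofReal_comp.mul
      (hasDerivAt_hankelKernel_cons hc hl0 (hu.trans_lt hx.1))).sub (hlin x)).congr_deriv
        (by push_cast; ring))
    (fun x => by simpa using (hasDerivAt_id x).const_mul ((a * Real.exp a + 1) * C * ε))
    (fun x hx => by
      have hx0 : 0 ≤ x := hu.trans hx.1.le
      set y := a * (x - u) with hy
      have hy0 : 0 ≤ y := mul_nonneg ha.le (by linarith [hx.1])
      have hya : y ≤ a * ε := mul_le_mul_of_nonneg_left (by linarith [hx.2]) ha.le
      have hya' : y ≤ a := hya.trans (mul_le_of_le_one_right ha.le hε1)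
      have e1 : Real.exp y - 1 ≤ a * Real.exp a * ε := by
        have h1 : 1 - y ≤ Real.exp (-y) := by
          have := Real.add_one_le_exp (-y); linarith
        have h2 : Real.exp y * Real.exp (-y) = 1 := by rw [← Real.exp_add]; simp
        have h3 : Real.exp y - 1 ≤ y * Real.exp y := by nlinarith [Real.exp_pos y]
        have h4 : y * Real.exp y ≤ (a * ε) * Real.exp a := by gcongr
        linarith
      have e0 : 0 ≤ Real.exp y - 1 := by
        have := Real.one_le_exp hy0; linarith
      have e : ((Real.exp y : ℝ) : ℂ) * g x - g (u + ε)
          = ((Real.exp y - 1 : ℝ) : ℂ) * g x - (g (u + ε) - g x) := by push_cast; ring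
      rw [e]
      refine (norm_sub_le _ _).trans ?_
      rw [norm_mul, Complex.norm_real, Real.norm_of_nonneg e0]
      have h1 : (Real.exp y - 1) * ‖g x‖ ≤ a * Real.exp a * ε * C :=
        mul_le_mul e1 (hC x hx0) (norm_nonneg _) (by positivity)
      have h2 : ‖g (u + ε) - g x‖ ≤ C * ε :=
        (hL x (u + ε) hx0 hx.2.le).trans
          (mul_le_mul_of_nonneg_left (by linarith [hx.1]) hC0)
      linarith)
  simp only [add_sub_cancel_left, sub_self, mul_zero, Real.exp_zero, Complex.ofReal_one, one_mul,
    Complex.ofReal_zero, zero_mul, sub_zero] at h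
  have hq : ((Real.exp (-a * ε) : ℝ) : ℂ) * ((Real.exp (a * ε) : ℝ) : ℂ) = 1 := by
    rw [← Complex.ofReal_mul, ← Real.exp_add]; simp
  have e : G (u + ε) - ((Real.exp (-a * ε) : ℝ) : ℂ) * (ε * g (u + ε) + G u)
      = ((Real.exp (-a * ε) : ℝ) : ℂ)
        * (((Real.exp (a * ε) : ℝ) : ℂ) * G (u + ε) - (ε : ℂ) * g (u + ε) - G u) := by
    linear_combination (-G (u + ε)) * hq
  rw [e, norm_mul, Complex.norm_real, Real.norm_of_nonneg (Real.exp_pos _).le]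
  have hq1 : Real.exp (-a * ε) ≤ 1 := Real.exp_le_one_iff.2 (by nlinarith)
  refine (mul_le_of_le_one_left (norm_nonneg _) hq1).trans (h.trans (le_of_eq ?_))
  ring

/-- Rescaled complete homogeneous functions of geometric variables `e^{-aε}` converge to the
kernel, uniformly with an error `O(ε)`: both obey the same recursion up to `O(ε²)` in each step, and
the factor `e^{-aε} ≤ 1 - ε/2` keeps the errors from piling up. -/
theorem exists_norm_completeHomogeneous_sub_le {c : ℝ} (hc : 0 < c) (a : ℝ) (l : List ℝ)
    (hl : ∀ x ∈ a :: l, 1 ≤ x) :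
    ∃ C : ℝ, 0 ≤ C ∧ (∀ u, 0 ≤ u → ‖hankelKernel c (a :: l) u‖ ≤ C) ∧
      (∀ u v, 0 ≤ u → u ≤ v →
        ‖hankelKernel c (a :: l) v - hankelKernel c (a :: l) u‖ ≤ C * (v - u)) ∧
      ∀ ε : ℝ, 0 < ε → ε ≤ 1 → ∀ r : ℕ,
        ‖((ε ^ l.length
            * completeHomogeneous ((a :: l).map fun x => Real.exp (-x * ε)) r : ℝ) : ℂ)
          - hankelKernel c (a :: l) (r * ε)‖ ≤ C * ε := by
  induction l generalizing a with
  | nil =>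
    have ha : 1 ≤ a := hl a List.mem_cons_self
    have ha0 : 0 < a := zero_lt_one.trans_le ha
    refine ⟨a, ha0.le, fun u hu => ?_, fun u v hu huv => ?_, fun ε hε _ r => ?_⟩
    · rw [hankelKernel_singleton hc ha0 hu, Complex.norm_real,
        Real.norm_of_nonneg (Real.exp_pos _).le]
      exact (Real.exp_le_one_iff.2 (by nlinarith)).trans ha
    · rw [hankelKernel_singleton hc ha0 hu, hankelKernel_singleton hc ha0 (hu.trans huv),
        ← Complex.ofReal_sub, Complex.norm_real, Real.norm_eq_abs, abs_sub_comm]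
      have h1 : Real.exp (-(a * v)) ≤ Real.exp (-(a * u)) := Real.exp_le_exp.2 (by nlinarith)
      rw [abs_of_nonneg (by linarith)]
      have h2 : Real.exp (-(a * v)) = Real.exp (-(a * u)) * Real.exp (-(a * (v - u))) := by
        rw [← Real.exp_add]; congr 1; ring
      have h3 := Real.add_one_le_exp (-(a * (v - u)))
      have h4 : Real.exp (-(a * u)) ≤ 1 := Real.exp_le_one_iff.2 (by nlinarith)
      have h5 : 0 ≤ a * (v - u) := mul_nonneg ha0.le (by linarith)
      rw [h2]
      nlinarith [Real.exp_pos (-(a * u))]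
    · rw [hankelKernel_singleton hc ha0 (by positivity), List.length_nil, pow_zero, one_mul,
        List.map_cons, List.map_nil, completeHomogeneous_singleton, ← Real.exp_nat_mul]
      rw [show (r : ℝ) * (-a * ε) = -(a * (r * ε)) by ring, sub_self, norm_zero]
      positivity
  | cons b l ih =>
    obtain ⟨C, hC0, hC, hL, happ⟩ := ih b fun x hx => hl x (List.mem_cons_of_mem _ hx)
    have ha : 1 ≤ a := hl a List.mem_cons_self
    have ha0 : 0 < a := zero_lt_one.trans_le ha
    have hl0 : ∀ x ∈ a :: b :: l, 0 < x := fun x hx => zero_lt_one.trans_le (hl x hx)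
    set K₁ : ℝ := (a * Real.exp a + 1) * C with hK₁
    have hK₁0 : 0 ≤ K₁ := by positivity
    set K₂ : ℝ := C + a * C + K₁ with hK₂
    have hK₂0 : 0 ≤ K₂ := by positivity
    refine ⟨1 + 2 * K₂, by positivity, fun u hu => ?_, fun u v hu huv => ?_,
      fun ε hε hε1 r => ?_⟩
    · refine (norm_hankelKernel_cons_le hc hl hC hu).trans ?_
      nlinarith [mul_nonneg ha0.le hC0]
    · refine (norm_hankelKernel_cons_sub_le hc hl hC hu huv).trans ?_
      refine mul_le_mul_of_nonneg_right ?_ (by linarith)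
      nlinarith [mul_nonneg ha0.le hC0]
    · induction r with
      | zero =>
        rw [Nat.cast_zero, Nat.cast_zero, zero_mul, hankelKernel_zero hc hl0 (by simp),
          completeHomogeneous_zero, sub_zero, mul_one, Complex.norm_real,
          Real.norm_of_nonneg (by positivity), List.length_cons, pow_succ]
        have h1 : ε ^ l.length ≤ 1 := pow_le_one₀ hε.le hε1
        nlinarith
      | succ r ihr =>
        set q := Real.exp (-a * ε) with hq
        have hq0 : 0 < q := Real.exp_pos _
        have hq1 : q ≤ 1 - ε / 2 := by
          have h1 : q ≤ Real.exp (-ε) := Real.exp_le_exp.2 (by nlinarith)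
          have h2 : Real.exp (-ε) * Real.exp ε = 1 := by rw [← Real.exp_add]; simp
          have h3 := Real.add_one_le_exp ε
          have h4 := Real.exp_pos (-ε)
          nlinarith
        have hq2 : 1 - q ≤ a * ε := by
          have := Real.add_one_le_exp (-a * ε); linarith
        set u : ℝ := r * ε with hu
        have hu0 : 0 ≤ u := by positivity
        have hu1 : ((r + 1 : ℕ) : ℝ) * ε = u + ε := by push_cast; ring
        have hstep := norm_hankelKernel_step_le hc hl hC hL hε hε1 hu0
        have hsub := happ ε hε hε1 (r + 1)
        rw [hu1] at hsub ⊢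
        set g := hankelKernel c (b :: l) with hg
        set G := hankelKernel c (a :: b :: l) with hG
        set h₀ := completeHomogeneous ((a :: b :: l).map fun x => Real.exp (-x * ε)) with hh₀
        set h₁ := completeHomogeneous ((b :: l).map fun x => Real.exp (-x * ε)) with hh₁
        have hrec : h₀ ((r + 1 : ℕ) : ℤ) = q * h₀ (r : ℤ) + h₁ ((r + 1 : ℕ) : ℤ) := by
          push_cast
          exact completeHomogeneous_cons _ _ _
        -- The error in step `r + 1` in terms of the error in step `r`, up to
        -- terms that are `O(ε²)`.
        have e : ((ε ^ (b :: l).length * h₀ ((r + 1 : ℕ) : ℤ) : ℝ) : ℂ) - G (u + ε)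
            = (q : ℂ) * (((ε ^ (b :: l).length * h₀ (r : ℤ) : ℝ) : ℂ) - G u)
              + (ε : ℂ) * (((ε ^ l.length * h₁ ((r + 1 : ℕ) : ℤ) : ℝ) : ℂ) - g (u + ε))
              + (((1 - q) * ε : ℝ) : ℂ) * g (u + ε)
              - (G (u + ε) - (q : ℂ) * (ε * g (u + ε) + G u)) := by
          rw [hrec, List.length_cons, pow_succ]
          push_cast
          ring
        rw [e]
        have n1 : ‖(q : ℂ) * (((ε ^ (b :: l).length * h₀ (r : ℤ) : ℝ) : ℂ) - G u)‖
            ≤ (1 - ε / 2) * ((1 + 2 * K₂) * ε) := by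
          rw [norm_mul, Complex.norm_real, Real.norm_of_nonneg hq0.le]
          exact mul_le_mul hq1 ihr (norm_nonneg _) (by linarith)
        have n2 : ‖(ε : ℂ) * (((ε ^ l.length * h₁ ((r + 1 : ℕ) : ℤ) : ℝ) : ℂ) - g (u + ε))‖
            ≤ ε * (C * ε) := by
          rw [norm_mul, Complex.norm_real, Real.norm_of_nonneg hε.le]
          exact mul_le_mul_of_nonneg_left hsub hε.le
        have n3 : ‖(((1 - q) * ε : ℝ) : ℂ) * g (u + ε)‖ ≤ (a * ε) * ε * C := by
          have hq3 : 0 ≤ 1 - q := by linarith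
          rw [norm_mul, Complex.norm_real, Real.norm_of_nonneg (mul_nonneg hq3 hε.le)]
          exact mul_le_mul (mul_le_mul_of_nonneg_right hq2 hε.le) (hC _ (by linarith))
            (norm_nonneg _) (by positivity)
        refine (norm_sub_le _ _).trans ?_
        refine (add_le_add (norm_add₃_le.trans (add_le_add (add_le_add n1 n2) n3)) hstep).trans ?_
        nlinarith [sq_nonneg ε]

end

/-! ### The Meijer function as a kernel -/

section

open Complex Set Filter Topology

theorem prodInvAdd_append (l l' : List ℝ) (s : ℂ) :
    prodInvAdd (l ++ l') s = prodInvAdd l s * prodInvAdd l' s := by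
  unfold prodInvAdd
  rw [List.map_append, List.prod_append]

/-- The quotient of Gamma functions with integer difference of the arguments telescopes. -/
theorem Gamma_div_Gamma_eq_prodInvAdd {α β : ℕ} (hα : 1 ≤ α) (hαβ : α ≤ β) {s : ℂ}
    (hs : s ∈ slitPlane) :
    Complex.Gamma (α + s) / Complex.Gamma (β + s)
      = prodInvAdd ((List.Ico α β).map fun i : ℕ => (i : ℝ)) s := by
  have hne : ∀ i : ℕ, 1 ≤ i → (i : ℂ) + s ≠ 0 := fun i hi => by
    have := ofReal_add_ne_zero (a := (i : ℝ)) (by exact_mod_cast hi) hs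
    simpa using this
  have hG : ∀ i : ℕ, 1 ≤ i → Complex.Gamma (i + s) ≠ 0 := by
    intro i hi
    refine Complex.Gamma_ne_zero fun j h => ?_
    refine hne (i + j) (by omega) ?_
    push_cast
    linear_combination h
  induction β, hαβ using Nat.le_induction with
  | base => simp [prodInvAdd, div_self (hG α hα)]
  | succ β hαβ ih =>
    have hβ : 1 ≤ β := hα.trans hαβ
    rw [List.Ico.succ_top hαβ, List.map_append, prodInvAdd_append, ← ih]
    have h1 : (((β + 1 : ℕ) : ℂ) + s) = ((β : ℂ) + s) + 1 := by push_cast; ring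
    rw [h1, Complex.Gamma_add_one _ (hne β hβ)]
    simp only [prodInvAdd, List.map_cons, List.map_nil, List.prod_cons, List.prod_nil, mul_one,
      ofReal_natCast]
    have h2 := hne β hβ
    have h3 := hG β hβ
    field_simp

theorem prodInvAdd_flatMap (f : ℕ → List ℝ) (q : ℕ) (s : ℂ) :
    prodInvAdd ((List.Ico 2 (q + 2)).flatMap f) s = ∏ r : Fin q, prodInvAdd (f (r + 2)) s := by
  induction q with
  | zero => simp [prodInvAdd]
  | succ q ih =>
    rw [show q + 1 + 2 = (q + 2) + 1 by ring, List.Ico.succ_top (by omega), List.flatMap_append,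
      prodInvAdd_append, ih, Fin.prod_univ_castSucc]
    simp

theorem length_flatMap_Ico (f : ℕ → List ℕ) (p : ℕ) :
    ((List.Ico 1 (p + 1)).flatMap f).length = ∑ k ∈ Finset.Icc 1 p, (f k).length := by
  induction p with
  | zero => simp
  | succ p ih =>
    rw [List.Ico.succ_top (by omega), List.flatMap_append, List.length_append, ih,
      Finset.sum_Icc_succ_top (by omega)]
    simp

/-- The exponents in the last `p - 1` of the geometric series. -/
def tailExponents (n p : ℕ) (m ν : ℕ → ℕ) : List ℕ :=
  (List.Ico 2 (p + 1)).flatMap fun r => List.Ico (1 + ν r) (m r - n + 1)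

/-- The exponents that remain in the `k`-th column once `k` exponents at the lower end and
`n - 1 - k` exponents at the upper end of the first geometric series have been left out. -/
def columnExponents (n p : ℕ) (m ν : ℕ → ℕ) (k : ℕ) : List ℕ :=
  List.Ico (ν 1 + 1 + k) (m 1 - 2 * n + k + 2) ++ tailExponents n p m ν

theorem one_le_of_mem_columnExponents {n p : ℕ} {m ν : ℕ → ℕ} {k i : ℕ}
    (hi : i ∈ columnExponents n p m ν k) : 1 ≤ i := by
  simp only [columnExponents, tailExponents, List.mem_append, List.Ico.mem, List.mem_flatMap] at hi
  rcases hi with hi | ⟨r, -, hi⟩ <;> omega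

theorem Ico_append_tailExponents {n p : ℕ} (hp : 1 ≤ p) (m ν : ℕ → ℕ) :
    List.Ico (1 + ν 1) (m 1 - n + 1) ++ tailExponents n p m ν
      = (List.Ico 1 (p + 1)).flatMap fun r => List.Ico (1 + ν r) (m r - n + 1) := by
  rw [List.Ico.eq_cons (by omega : 1 < p + 1), List.flatMap_cons]
  rfl

theorem geometricSeriesUnion_eq_map {n p : ℕ} (hp : 1 ≤ p) (m ν : ℕ → ℕ) (ε : ℝ) :
    geometricSeriesUnion n p m ν ε
      = (List.Ico (1 + ν 1) (m 1 - n + 1) ++ tailExponents n p m ν).map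
          fun i : ℕ => Real.exp (-(i : ℝ) * ε) := by
  rw [Ico_append_tailExponents hp, List.map_flatMap]
  unfold geometricSeriesUnion
  -- In `geometricSeriesUnion` the lists of exponents are cast to `ℝ` by the list monad.
  simp only [List.bind_eq_flatMap, List.pure_def, List.map_flatMap, List.map_cons, List.map_nil]
  simp only [List.map_eq_flatMap]

/-- The exponents left out in the `k`-th column, followed by the remaining ones, are a rearrangement
of all exponents. -/
theorem Ico_append_columnExponents {n p : ℕ} {m ν : ℕ → ℕ} (hm₁ : 2 * n + ν 1 ≤ m 1) {k : ℕ}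
    (hk : k < n) :
    (List.Ico (ν 1 + 1) (ν 1 + 1 + k) ++ List.Ico (m 1 - 2 * n + k + 2) (m 1 - n + 1)
        ++ columnExponents n p m ν k).Perm
      (List.Ico (1 + ν 1) (m 1 - n + 1) ++ tailExponents n p m ν) := by
  rw [columnExponents, ← List.append_assoc]
  refine List.Perm.append_right _ ?_
  rw [List.append_assoc]
  refine ((List.perm_append_comm).append_left _).trans ?_
  rw [← List.append_assoc, List.Ico.append_consecutive (by omega) (by omega),
    List.Ico.append_consecutive (by omega) (by omega), add_comm]

/-- On the slit plane the integrand of the Meijer function of the theorem is the rational function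
attached to `columnExponents`, times an exponential. -/
theorem meijerIntegrand_eq {n p : ℕ} (hp : 1 ≤ p) {m ν : ℕ → ℕ} (hm₁ : 2 * n + ν 1 ≤ m 1)
    (hm : ∀ k ∈ Finset.Icc 2 p, n + ν k + 1 ≤ m k) (k : ℕ) (u : ℝ) {s : ℂ} (hs : s ∈ slitPlane) :
    meijerIntegrand (upperParameters n p m (k + 1)) (lowerParameters p ν (k + 1))
        (Real.exp (-u)) s
      = prodInvAdd ((columnExponents n p m ν k).map fun i : ℕ => (i : ℝ)) s * cexp (u * s) := by
  obtain ⟨q, rfl⟩ : ∃ q, p = q + 1 := ⟨p - 1, by omega⟩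
  unfold meijerIntegrand
  congr 1
  · rw [← Finset.prod_div_distrib, Fin.prod_univ_succ, columnExponents, List.map_append,
      prodInvAdd_append, tailExponents, List.map_flatMap, prodInvAdd_flatMap]
    congr 1
    · rw [← Gamma_div_Gamma_eq_prodInvAdd (by omega) (by omega) hs]
      have h1 : ((lowerParameters (q + 1) ν (k + 1) 0 : ℝ) : ℂ) = ((ν 1 + 1 + k : ℕ) : ℂ) := by
        simp only [lowerParameters, Fin.val_zero, if_true]
        push_cast; ring
      have h2 : ((upperParameters n (q + 1) m (k + 1) 0 : ℝ) : ℂ)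
          = ((m 1 - 2 * n + k + 2 : ℕ) : ℂ) := by
        simp only [upperParameters, Fin.val_zero, if_true]
        push_cast [Nat.cast_sub (show 2 * n ≤ m 1 by omega)]; ring
      rw [h1, h2]
    · refine Finset.prod_congr rfl fun r _ => ?_
      have hr := r.2
      have hmr := hm (r + 2) (Finset.mem_Icc.2 ⟨by omega, by omega⟩)
      rw [← Gamma_div_Gamma_eq_prodInvAdd (by omega) (by omega) hs]
      have h1 : ((lowerParameters (q + 1) ν (k + 1) r.succ : ℝ) : ℂ)
          = ((1 + ν (r + 2) : ℕ) : ℂ) := by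
        simp only [lowerParameters, Fin.val_succ, Nat.add_eq_zero_iff, one_ne_zero, and_false,
          if_false]
        push_cast; ring
      have h2 : ((upperParameters n (q + 1) m (k + 1) r.succ : ℝ) : ℂ)
          = ((m (r + 2) - n + 1 : ℕ) : ℂ) := by
        simp only [upperParameters, Fin.val_succ, Nat.add_eq_zero_iff, one_ne_zero, and_false,
          if_false]
        push_cast [Nat.cast_sub (show n ≤ m (r + 2) by omega)]; ring
      rw [h1, h2]
  · have h0 : ((Real.exp (-u) : ℝ) : ℂ) ≠ 0 := ofReal_ne_zero.2 (Real.exp_pos _).ne'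
    rw [cpow_def_of_ne_zero h0, ← ofReal_log (Real.exp_pos _).le, Real.log_exp]
    push_cast
    ring_nf

theorem meijerG_eq_hankelKernel {n p : ℕ} (hp : 1 ≤ p) {m ν : ℕ → ℕ} (hm₁ : 2 * n + ν 1 ≤ m 1)
    (hm : ∀ k ∈ Finset.Icc 2 p, n + ν k + 1 ≤ m k) (k : ℕ) (u : ℝ) :
    meijerG (upperParameters n p m (k + 1)) (lowerParameters p ν (k + 1)) (Real.exp (-u))
      = hankelKernel (1 + ∑ j, |lowerParameters p ν (k + 1) j|)
          ((columnExponents n p m ν k).map fun i : ℕ => (i : ℝ)) u := by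
  have hc : 0 < 1 + ∑ j, |lowerParameters p ν (k + 1) j| := by positivity
  exact hankelIntegral_congr hc fun s hs => meijerIntegrand_eq hp hm₁ hm k u hs

theorem prod_Ico_sub_eq_Gamma_div {α β : ℕ} (hαβ : α ≤ β) {z : ℝ} (hz : z < α) :
    ((List.Ico α β).map fun i : ℕ => (i : ℝ) - z).prod
      = Real.Gamma (β - z) / Real.Gamma (α - z) := by
  induction β, hαβ using Nat.le_induction with
  | base => simp [div_self (Real.Gamma_pos_of_pos (sub_pos.2 hz)).ne']
  | succ β hαβ ih =>
    have hβ : (0 : ℝ) < β - z := by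
      have : (α : ℝ) ≤ β := by exact_mod_cast hαβ
      linarith
    have h1 : ((β + 1 : ℕ) : ℝ) - z = (β - z) + 1 := by push_cast; ring
    rw [List.Ico.succ_top hαβ, List.map_append, List.prod_append, ih, h1,
      Real.Gamma_add_one hβ.ne']
    simp
    ring

theorem tendsto_exp_sub_exp_div (α β : ℝ) :
    Tendsto (fun ε : ℝ => (Real.exp (-α * ε) - Real.exp (-β * ε)) / ε) (𝓝[>] 0) (𝓝 (β - α)) := by
  have h1 : ∀ γ : ℝ, HasDerivAt (fun ε : ℝ => Real.exp (-γ * ε)) (-γ) 0 := by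
    intro γ
    have h2 : HasDerivAt (fun ε : ℝ => -γ * ε) (-γ) 0 := by
      simpa using (hasDerivAt_id (0 : ℝ)).const_mul (-γ)
    simpa using h2.exp
  have h3 := ((h1 α).sub (h1 β)).tendsto_slope_zero_right
  have h4 : -α - -β = β - α := by ring
  rw [h4] at h3
  refine h3.congr fun ε => ?_
  simp [div_eq_inv_mul]

theorem prod_map_div_const (l : List ℕ) (f : ℕ → ℝ) (ε : ℝ) :
    (l.map fun i => f i / ε).prod = (l.map f).prod / ε ^ l.length := by
  induction l with
  | nil => simp
  | cons a l ih =>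
    rw [List.map_cons, List.prod_cons, ih, List.map_cons, List.prod_cons, List.length_cons,
      pow_succ', div_mul_div_comm]

end

/-! ### The change of columns and the limit -/

section

open Set Filter Topology

/-- The determinant of the change of columns between the two variants of the Jacobi–Trudi
identity. The factor of the `k`-th column compares the exponent `ν_1 + 1 + k` with the exponents
left out at the upper end of the first geometric series. -/
noncomputable def columnChange (n : ℕ) (m ν : ℕ → ℕ) (ε : ℝ) : ℝ :=
  ∏ k : Fin n, ((List.Ico (m 1 - 2 * n + k + 2) (m 1 - n + 1)).map fun i : ℕ =>
    Real.exp (-((ν 1 + 1 + k : ℕ) : ℝ) * ε) - Real.exp (-(i : ℝ) * ε)).prod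

theorem columnChange_mul_schurFunction {n p : ℕ} (hp : 1 ≤ p) {m ν : ℕ → ℕ}
    (hm₁ : 2 * n + ν 1 ≤ m 1) {ε : ℝ} (hε : ε ≠ 0) {μ : YoungDiagram} (hμ : μ.colLen 0 ≤ n) :
    columnChange n m ν ε * schurFunction μ (geometricSeriesUnion n p m ν ε)
      = Matrix.det (Matrix.of fun i k : Fin n => completeHomogeneous
          (((columnExponents n p m ν k).map fun i : ℕ => (i : ℝ)).map
            fun x : ℝ => Real.exp (-x * ε))
          ((μ.rowLen i + (n - 1 - i) : ℕ) : ℤ)) := by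
  have hw : Function.Injective fun i : ℕ => Real.exp (-((ν 1 + 1 + i : ℕ) : ℝ) * ε) := by
    intro i j h
    have h1 := mul_right_cancel₀ hε (Real.exp_injective h)
    have h2 : (ν 1 + 1 + i : ℕ) = (ν 1 + 1 + j : ℕ) := by exact_mod_cast neg_injective h1
    omega
  have key := prod_mul_schurFunction_eq_det (n := n) (y := geometricSeriesUnion n p m ν ε)
    (w := fun i : ℕ => Real.exp (-((ν 1 + 1 + i : ℕ) : ℝ) * ε)) hw
    (T := fun k => (List.Ico (m 1 - 2 * n + k + 2) (m 1 - n + 1)).map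
      fun i : ℕ => Real.exp (-(i : ℝ) * ε))
    (l := fun k => (columnExponents n p m ν k).map fun i : ℕ => Real.exp (-(i : ℝ) * ε))
    (fun k => by
      have := k.2
      rw [List.length_map, List.Ico.length]; omega)
    (fun k => by
      rw [geometricSeriesUnion_eq_map hp]
      have h1 := (Ico_append_columnExponents (p := p) hm₁ k.2).map
        fun i : ℕ => Real.exp (-(i : ℝ) * ε)
      have h2 : (List.Ico (ν 1 + 1) (ν 1 + 1 + k)).map (fun i : ℕ => Real.exp (-(i : ℝ) * ε))
          = (List.range k).map fun i : ℕ => Real.exp (-((ν 1 + 1 + i : ℕ) : ℝ) * ε) := by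
        have h3 := List.Ico.map_add 0 k (ν 1 + 1)
        rw [List.Ico.zero_bot, zero_add, add_comm (k : ℕ)] at h3
        rw [← h3, List.map_map]
        rfl
      rw [List.map_append, List.map_append, h2] at h1
      exact h1)
    hμ
  simp only [List.map_map] at key ⊢
  refine key.trans ?_
  congr 1
  ext i k
  have hi := i.2
  simp only [Matrix.of_apply]
  congr 1
  omega

theorem length_columnExponents {n p : ℕ} (hp : 1 ≤ p) {m ν : ℕ → ℕ}
    (hm₁ : 2 * n + ν 1 ≤ m 1) (hm : ∀ k ∈ Finset.Icc 2 p, n + ν k + 1 ≤ m k) {k : ℕ}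
    (hk : k < n) :
    ((columnExponents n p m ν k).length : ℤ) + n
      = ∑ r ∈ Finset.Icc 1 p, ((m r : ℤ) - n - ν r) + 1 := by
  have h1 := (Ico_append_columnExponents (p := p) hm₁ hk).length_eq
  rw [Ico_append_tailExponents hp, length_flatMap_Ico] at h1
  simp only [List.length_append, List.Ico.length] at h1
  have h2 : ((∑ r ∈ Finset.Icc 1 p, (m r - n + 1 - (1 + ν r)) : ℕ) : ℤ)
      = ∑ r ∈ Finset.Icc 1 p, ((m r : ℤ) - n - ν r) := by
    push_cast
    refine Finset.sum_congr rfl fun r hr => ?_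
    rw [Finset.mem_Icc] at hr
    have : n + ν r ≤ m r := by
      rcases hr.1.eq_or_lt with rfl | h
      · omega
      · have := hm r (Finset.mem_Icc.2 ⟨h, hr.2⟩)
        omega
    omega
  omega

theorem sum_sub_one_sub_eq (n : ℕ) :
    (∑ k : Fin n, ((n : ℤ) - 1 - (k : ℕ))) = n * n - (n : ℤ) * (n + 1) / 2 := by
  have h1 : (∑ k : Fin n, ((n : ℤ) - 1 - (k : ℕ))) * 2 = n * n - n := by
    have h2 : ∀ j : ℕ, (∑ i ∈ Finset.range j, ((n : ℤ) - 1 - i)) * 2 = j * (2 * n - 1 - j) := by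
      intro j
      induction j with
      | zero => simp
      | succ j ih => rw [Finset.sum_range_succ, add_mul, ih]; push_cast; ring
    rw [← Finset.sum_range fun i : ℕ => ((n : ℤ) - 1 - i), h2]
    ring
  have h3 : (n : ℤ) * (n + 1) = 2 * (n * n - ∑ k : Fin n, ((n : ℤ) - 1 - (k : ℕ))) := by
    linear_combination h1
  rw [h3, Int.mul_ediv_cancel_left _ two_ne_zero]
  ring

theorem prod_Gamma_sub_eq {n : ℕ} (a : ℝ) :
    ∏ k : Fin n, Real.Gamma (a + n - (k : ℕ)) = ∏ j ∈ Finset.Icc 1 n, Real.Gamma (a + j) := by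
  rw [← Finset.prod_range fun k : ℕ => Real.Gamma (a + n - k)]
  refine Finset.prod_bij' (fun k _ => n - k) (fun j _ => n - j) ?_ ?_ ?_ ?_ ?_
  · intro k hk; simp only [Finset.mem_range, Finset.mem_Icc] at hk ⊢; omega
  · intro k hk; simp only [Finset.mem_range, Finset.mem_Icc] at hk ⊢; omega
  · intro k hk; simp only [Finset.mem_range] at hk; omega
  · intro k hk; simp only [Finset.mem_Icc] at hk; omega
  · intro k hk
    simp only [Finset.mem_range] at hk
    rw [Nat.cast_sub hk.le]
    congr 1
    ring

/-- Each of the `∑ (n - 1 - k)` factors `e^{-αε} - e^{-iε}` is asymptotic to `(i - α) ε`, and the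
product over `i` of the numbers `i - α` in one column is a quotient of Gamma values. -/
theorem tendsto_columnChange {n : ℕ} {m ν : ℕ → ℕ} (hm₁ : 2 * n + ν 1 ≤ m 1) :
    Tendsto (fun ε : ℝ => columnChange n m ν ε / ε ^ (∑ k : Fin n, (n - 1 - (k : ℕ)))) (𝓝[>] 0)
      (𝓝 ((∏ j ∈ Finset.Icc 1 n, Real.Gamma ((m 1 : ℝ) - 2 * n - ν 1 + j))
        / Real.Gamma ((m 1 : ℝ) - 2 * n - ν 1 + 1) ^ n)) := by
  have hcast : ((m 1 - 2 * n : ℕ) : ℝ) = (m 1 : ℝ) - 2 * n := by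
    push_cast [Nat.cast_sub (show 2 * n ≤ m 1 by omega)]; ring
  have hcast' : ((m 1 - n : ℕ) : ℝ) = (m 1 : ℝ) - n := by
    push_cast [Nat.cast_sub (show n ≤ m 1 by omega)]; ring
  have hν : (ν 1 : ℝ) ≤ ((m 1 - 2 * n : ℕ) : ℝ) := by exact_mod_cast (by omega)
  have hlim : (∏ j ∈ Finset.Icc 1 n, Real.Gamma ((m 1 : ℝ) - 2 * n - ν 1 + j))
        / Real.Gamma ((m 1 : ℝ) - 2 * n - ν 1 + 1) ^ n
      = ∏ k : Fin n, ((List.Ico (m 1 - 2 * n + k + 2) (m 1 - n + 1)).map fun i : ℕ =>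
          (i : ℝ) - ((ν 1 + 1 + k : ℕ) : ℝ)).prod := by
    have h1 : ∀ k : Fin n, ((List.Ico (m 1 - 2 * n + k + 2) (m 1 - n + 1)).map fun i : ℕ =>
          (i : ℝ) - ((ν 1 + 1 + k : ℕ) : ℝ)).prod
        = Real.Gamma (((m 1 : ℝ) - 2 * n - ν 1) + n - (k : ℕ))
          / Real.Gamma ((m 1 : ℝ) - 2 * n - ν 1 + 1) := by
      intro k
      have hk := k.2
      rw [prod_Ico_sub_eq_Gamma_div (by omega)]
      · congr 2
        · push_cast; rw [hcast']; ring
        · push_cast; rw [hcast]; ring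
      · push_cast; linarith
    simp only [h1]
    rw [Finset.prod_div_distrib, Finset.prod_const, Finset.card_univ, Fintype.card_fin,
      prod_Gamma_sub_eq]
  rw [hlim]
  have heq : ∀ ε : ℝ, columnChange n m ν ε / ε ^ (∑ k : Fin n, (n - 1 - (k : ℕ)))
      = ∏ k : Fin n, ((List.Ico (m 1 - 2 * n + k + 2) (m 1 - n + 1)).map fun i : ℕ =>
        (Real.exp (-((ν 1 + 1 + k : ℕ) : ℝ) * ε) - Real.exp (-(i : ℝ) * ε)) / ε).prod := by
    intro ε
    rw [columnChange, ← Finset.prod_pow_eq_pow_sum, ← Finset.prod_div_distrib]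
    refine Finset.prod_congr rfl fun k _ => ?_
    have hk := k.2
    have hlen : (List.Ico (m 1 - 2 * n + k + 2) (m 1 - n + 1)).length = n - 1 - (k : ℕ) := by
      rw [List.Ico.length]; omega
    rw [prod_map_div_const, hlen]
  simp only [heq]
  exact tendsto_finsetProd _ fun k _ => tendsto_list_prod _ fun i _ => tendsto_exp_sub_exp_div _ _

/-- The power of `ε` in front of the Schur function is distributed over the columns of the
determinant and the change of columns. -/
theorem zpow_mul_schurFunction_eq {n p : ℕ} (hp : 1 ≤ p) {m ν : ℕ → ℕ}
    (hm₁ : 2 * n + ν 1 ≤ m 1) (hm : ∀ k ∈ Finset.Icc 2 p, n + ν k + 1 ≤ m k) {ε : ℝ}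
    (hε : 0 < ε)
    (hne : columnChange n m ν ε / ε ^ (∑ k : Fin n, (n - 1 - (k : ℕ))) ≠ 0)
    {μ : YoungDiagram} (hμ : μ.colLen 0 ≤ n) :
    ε ^ ((∑ k ∈ Finset.Icc 1 p, ((m k : ℤ) - n - ν k) * n) - (n : ℤ) * (n + 1) / 2)
        * schurFunction μ (geometricSeriesUnion n p m ν ε)
      = (columnChange n m ν ε / ε ^ (∑ k : Fin n, (n - 1 - (k : ℕ))))⁻¹
        * Matrix.det (Matrix.of fun i k : Fin n =>
          ε ^ ((columnExponents n p m ν k).length - 1) * completeHomogeneous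
            (((columnExponents n p m ν k).map fun i : ℕ => (i : ℝ)).map
              fun x : ℝ => Real.exp (-x * ε))
            ((μ.rowLen i + (n - 1 - i) : ℕ) : ℤ)) := by
  have hpos : ∀ k : Fin n, 1 ≤ (columnExponents n p m ν k).length := by
    intro k
    rw [columnExponents, List.length_append, List.Ico.length]
    omega
  refine Eq.trans ?_ (congrArg _ (Matrix.det_mul_row
    (fun k : Fin n => ε ^ ((columnExponents n p m ν k).length - 1))
    (Matrix.of fun i k : Fin n => completeHomogeneous
      (((columnExponents n p m ν k).map fun i : ℕ => (i : ℝ)).map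
        fun x : ℝ => Real.exp (-x * ε))
      ((μ.rowLen i + (n - 1 - i) : ℕ) : ℤ))).symm)
  rw [Finset.prod_pow_eq_pow_sum, ← columnChange_mul_schurFunction hp hm₁ hε.ne' hμ]
  have hexp : (∑ k ∈ Finset.Icc 1 p, ((m k : ℤ) - n - ν k) * n) - (n : ℤ) * (n + 1) / 2
      = ((∑ k : Fin n, ((columnExponents n p m ν k).length - 1)
          + ∑ k : Fin n, (n - 1 - (k : ℕ)) : ℕ) : ℤ) := by
    have h1 : ((∑ k : Fin n, (n - 1 - (k : ℕ)) : ℕ) : ℤ)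
        = ∑ k : Fin n, ((n : ℤ) - 1 - (k : ℕ)) := by
      push_cast
      refine Finset.sum_congr rfl fun k _ => ?_
      have := k.2
      omega
    have h2 : ((∑ k : Fin n, ((columnExponents n p m ν k).length - 1) : ℕ) : ℤ)
        = ∑ k : Fin n, (∑ r ∈ Finset.Icc 1 p, ((m r : ℤ) - n - ν r) - n) := by
      push_cast
      refine Finset.sum_congr rfl fun k _ => ?_
      have h3 := length_columnExponents hp hm₁ hm k.2
      have h4 := hpos k
      omega
    rw [Nat.cast_add, h1, h2, sum_sub_one_sub_eq, Finset.sum_const, Finset.card_univ,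
      Fintype.card_fin, ← Finset.sum_mul]
    simp only [nsmul_eq_mul]
    ring
  rw [hexp, zpow_natCast, pow_add]
  have hε' : ε ^ (∑ k : Fin n, (n - 1 - (k : ℕ))) ≠ 0 := pow_ne_zero _ hε.ne'
  have hD : columnChange n m ν ε ≠ 0 := fun h => hne (by rw [h, zero_div])
  field_simp

/-- The uniform approximation of a single matrix entry. The shift `d = n - 1 - i` of the index in
the `i`-th row is absorbed by the Lipschitz bound. -/
theorem exists_norm_entry_sub_le {n p : ℕ} (hp : 1 ≤ p) {m ν : ℕ → ℕ}
    (hm₁ : 2 * n + ν 1 ≤ m 1) (hm : ∀ k ∈ Finset.Icc 2 p, n + ν k + 1 ≤ m k) (k : Fin n) :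
    ∃ C : ℝ, 0 ≤ C ∧ ∀ ε : ℝ, 0 < ε → ε ≤ 1 → ∀ r d : ℕ, d ≤ n →
      ‖meijerG (upperParameters n p m ((k : ℕ) + 1)) (lowerParameters p ν ((k : ℕ) + 1))
          (Real.exp (-ε * r))‖ ≤ C ∧
      ‖((ε ^ ((columnExponents n p m ν k).length - 1) * completeHomogeneous
            (((columnExponents n p m ν k).map fun i : ℕ => (i : ℝ)).map
              fun x : ℝ => Real.exp (-x * ε)) ((r + d : ℕ) : ℤ) : ℝ) : ℂ)
        - meijerG (upperParameters n p m ((k : ℕ) + 1)) (lowerParameters p ν ((k : ℕ) + 1))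
          (Real.exp (-ε * r))‖ ≤ C * ε := by
  set c : ℝ := 1 + ∑ j, |lowerParameters p ν ((k : ℕ) + 1) j| with hcdef
  have hc : 0 < c := by positivity
  have hne : (columnExponents n p m ν k).map (fun i : ℕ => (i : ℝ)) ≠ [] := by
    intro h
    have h1 := congrArg List.length h
    rw [List.length_map, columnExponents, List.length_append, List.Ico.length,
      List.length_nil] at h1
    omega
  obtain ⟨a, l, hal⟩ := List.exists_cons_of_ne_nil hne
  have hl : ∀ x ∈ a :: l, 1 ≤ x := by
    intro x hx
    rw [← hal] at hx
    obtain ⟨i, hi, rfl⟩ := List.mem_map.1 hx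
    exact_mod_cast one_le_of_mem_columnExponents hi
  have hlen : (columnExponents n p m ν k).length - 1 = l.length := by
    have h1 := congrArg List.length hal
    rw [List.length_map, List.length_cons] at h1
    omega
  obtain ⟨C, hC0, hC, hL, happ⟩ := exists_norm_completeHomogeneous_sub_le hc a l hl
  refine ⟨C * (n + 1), by positivity, fun ε hε hε1 r d hd => ?_⟩
  have hu : 0 ≤ (r : ℝ) * ε := by positivity
  have hmeijer : meijerG (upperParameters n p m ((k : ℕ) + 1))
      (lowerParameters p ν ((k : ℕ) + 1)) (Real.exp (-ε * r))
        = hankelKernel c (a :: l) (r * ε) := by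
    rw [← hal, hcdef, ← meijerG_eq_hankelKernel hp hm₁ hm]
    congr 2
    ring
  rw [hmeijer, hal, hlen]
  constructor
  · refine (hC _ hu).trans ?_
    nlinarith [(Nat.cast_nonneg n : (0 : ℝ) ≤ n)]
  · have h1 := happ ε hε hε1 (r + d)
    have hd0 : 0 ≤ (d : ℝ) * ε := by positivity
    have h2 := hL (r * ε) ((r + d : ℕ) * ε) hu (by push_cast; linarith)
    have h3 : C * (((r + d : ℕ) : ℝ) * ε - r * ε) ≤ C * (n * ε) := by
      refine mul_le_mul_of_nonneg_left ?_ hC0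
      have : (d : ℝ) ≤ n := by exact_mod_cast hd
      push_cast
      nlinarith
    refine (norm_sub_le_norm_sub_add_norm_sub _ _ _).trans ((add_le_add h1 (h2.trans h3)).trans ?_)
    linarith

theorem mainTheorem6 (n p : ℕ) (hn : 1 ≤ n) (hp : 1 ≤ p) (m ν : ℕ → ℕ)
    (hm₁ : 2 * n + ν 1 ≤ m 1)
    (hm : ∀ k ∈ Finset.Icc 2 p, n + ν k + 1 ≤ m k) :
    ∀ δ : ℝ, 0 < δ → ∃ ε₀ : ℝ, 0 < ε₀ ∧ ∀ ε : ℝ, 0 < ε → ε < ε₀ →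
      ∀ lam : YoungDiagram, lam.colLen 0 ≤ n →
        ∀ x : Fin n → ℝ, (∀ j : Fin n, x j = Real.exp (-ε * (lam.rowLen j : ℝ))) →
          ‖((ε ^ ((∑ k ∈ Finset.Icc 1 p, ((m k : ℤ) - n - ν k) * n) - (n : ℤ) * (n + 1) / 2)
                * schurFunction lam (geometricSeriesUnion n p m ν ε) : ℝ) : ℂ)
            - ((Real.Gamma ((m 1 : ℝ) - 2 * n - ν 1 + 1) ^ n
                / ∏ j ∈ Finset.Icc 1 n, Real.Gamma ((m 1 : ℝ) - 2 * n - ν 1 + j) : ℝ) : ℂ)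
              * Matrix.det (Matrix.of fun j k : Fin n =>
                  meijerG (upperParameters n p m ((k : ℕ) + 1))
                    (lowerParameters p ν ((k : ℕ) + 1)) (x j))‖ < δ := by
  intro δ hδ
  choose C hC0 hC using exists_norm_entry_sub_le hp hm₁ hm
  set B : ℝ := ∑ k, C k with hB
  have hB0 : 0 ≤ B := Finset.sum_nonneg fun k _ => hC0 k
  have hCB : ∀ k, C k ≤ B := fun k =>
    Finset.single_le_sum (f := C) (fun k _ => hC0 k) (Finset.mem_univ k)
  -- The limit `t` of the reciprocal column change factor.
  set t : ℝ := Real.Gamma ((m 1 : ℝ) - 2 * n - ν 1 + 1) ^ n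
    / ∏ j ∈ Finset.Icc 1 n, Real.Gamma ((m 1 : ℝ) - 2 * n - ν 1 + j) with ht
  set f : ℝ → ℝ := fun ε => columnChange n m ν ε / ε ^ (∑ k : Fin n, (n - 1 - (k : ℕ))) with hf
  have hMν : (0 : ℝ) ≤ (m 1 : ℝ) - 2 * n - ν 1 := by
    have : ((2 * n + ν 1 : ℕ) : ℝ) ≤ m 1 := by exact_mod_cast hm₁
    push_cast at this
    linarith
  have htpos : 0 < t := by
    refine div_pos (pow_pos (Real.Gamma_pos_of_pos (by linarith)) n)
      (Finset.prod_pos fun j hj => Real.Gamma_pos_of_pos ?_)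
    have : (1 : ℝ) ≤ j := by exact_mod_cast (Finset.mem_Icc.1 hj).1
    linarith
  have hlim : Tendsto f (𝓝[>] 0) (𝓝 t⁻¹) := by
    rw [ht, inv_div]
    exact tendsto_columnChange hm₁
  have hlim' : Tendsto (fun ε => (f ε)⁻¹) (𝓝[>] 0) (𝓝 t) := by
    simpa using hlim.inv₀ (inv_ne_zero htpos.ne')
  -- Uniform continuity of `(t, M) ↦ t * det M` on a compact set.
  set Φ : ℂ × (Fin n → Fin n → ℂ) → ℂ := fun z => z.1 * Matrix.det (Matrix.of z.2) with hΦ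
  have hΦc : Continuous Φ :=
    continuous_fst.mul (Continuous.matrix_det (by exact continuous_snd))
  have hΦu := (isCompact_closedBall (0 : ℂ × (Fin n → Fin n → ℂ))
    (t + 1 + 2 * B)).uniformContinuousOn_of_continuous hΦc.continuousOn
  obtain ⟨η, hη, hΦη⟩ := Metric.uniformContinuousOn_iff.1 hΦu δ hδ
  have hev : ∀ᶠ ε : ℝ in 𝓝[>] 0, f ε ≠ 0 ∧ |(f ε)⁻¹ - t| < min η 1 := by
    refine (hlim.eventually_ne (inv_ne_zero htpos.ne')).and ?_
    have := Metric.tendsto_nhds.1 hlim' (min η 1) (lt_min hη zero_lt_one)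
    simpa only [Real.dist_eq] using this
  obtain ⟨ε₁, hε₁, hε₁'⟩ := mem_nhdsGT_iff_exists_Ioo_subset.1 hev
  refine ⟨min ε₁ (min 1 (η / (2 * (B + 1)))), ?_, ?_⟩
  · exact lt_min hε₁ (lt_min one_pos (by positivity))
  intro ε hε hlt lam hlam x hx
  have hlt1 : ε < ε₁ := hlt.trans_le (min_le_left _ _)
  have hle1 : ε ≤ 1 := (hlt.trans_le ((min_le_right _ _).trans (min_le_left _ _))).le
  have hltη : ε < η / (2 * (B + 1)) :=
    hlt.trans_le ((min_le_right _ _).trans (min_le_right _ _))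
  obtain ⟨hne, hft⟩ := hε₁' ⟨hε, hlt1⟩
  have hBε : B * ε < η := by
    rw [lt_div_iff₀ (by positivity)] at hltη
    nlinarith
  set H : Fin n → Fin n → ℂ := fun i k =>
    ((ε ^ ((columnExponents n p m ν k).length - 1) * completeHomogeneous
      (((columnExponents n p m ν k).map fun i : ℕ => (i : ℝ)).map
        fun x : ℝ => Real.exp (-x * ε)) ((lam.rowLen i + (n - 1 - i) : ℕ) : ℤ) : ℝ) : ℂ) with hH
  set G : Fin n → Fin n → ℂ := fun i k =>
    meijerG (upperParameters n p m ((k : ℕ) + 1)) (lowerParameters p ν ((k : ℕ) + 1)) (x i) with hG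
  have hGH : ∀ i k, ‖G i k‖ ≤ B ∧ ‖H i k - G i k‖ ≤ B * ε := by
    intro i k
    have h := hC k ε hε hle1 (lam.rowLen i) (n - 1 - i) (by omega)
    rw [← hx i] at h
    exact ⟨h.1.trans (hCB k), h.2.trans (mul_le_mul_of_nonneg_right (hCB k) hε.le)⟩
  have hBε' : B * ε ≤ B := mul_le_of_le_one_right hB0 hle1
  have hH2 : ∀ i k, ‖H i k‖ ≤ 2 * B := by
    intro i k
    have h1 : H i k = (H i k - G i k) + G i k := by ring
    rw [h1]
    refine (norm_add_le _ _).trans ?_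
    have := hGH i k
    linarith
  have hmem1 : ((((f ε)⁻¹ : ℝ) : ℂ), H) ∈ Metric.closedBall (0 : ℂ × (Fin n → Fin n → ℂ))
      (t + 1 + 2 * B) := by
    rw [mem_closedBall_zero_iff, Prod.norm_mk, max_le_iff]
    constructor
    · rw [Complex.norm_real, Real.norm_eq_abs]
      have h1 := (abs_lt.1 (hft.trans_le (min_le_right _ _)))
      rw [abs_le]
      constructor <;> linarith
    · refine (pi_norm_le_iff_of_nonneg (by linarith)).2 fun i =>
        (pi_norm_le_iff_of_nonneg (by linarith)).2 fun k => ?_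
      have := hH2 i k
      linarith
  have hmem2 : ((t : ℂ), G) ∈ Metric.closedBall (0 : ℂ × (Fin n → Fin n → ℂ))
      (t + 1 + 2 * B) := by
    rw [mem_closedBall_zero_iff, Prod.norm_mk, max_le_iff]
    constructor
    · rw [Complex.norm_real, Real.norm_of_nonneg htpos.le]
      linarith
    · refine (pi_norm_le_iff_of_nonneg (by linarith)).2 fun i =>
        (pi_norm_le_iff_of_nonneg (by linarith)).2 fun k => ?_
      have := (hGH i k).1
      linarith
  have hdist : dist ((((f ε)⁻¹ : ℝ) : ℂ), H) ((t : ℂ), G) < η := by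
    rw [Prod.dist_eq, max_lt_iff]
    constructor
    · rw [Complex.dist_eq, ← Complex.ofReal_sub, Complex.norm_real, Real.norm_eq_abs]
      exact hft.trans_le (min_le_left _ _)
    · refine (dist_pi_lt_iff hη).2 fun i => (dist_pi_lt_iff hη).2 fun k => ?_
      rw [Complex.dist_eq]
      exact (hGH i k).2.trans_lt hBε
  have hfinal := hΦη _ hmem1 _ hmem2 hdist
  rw [Complex.dist_eq] at hfinal
  have hleft : ((ε ^ ((∑ k ∈ Finset.Icc 1 p, ((m k : ℤ) - n - ν k) * n) - (n : ℤ) * (n + 1) / 2)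
        * schurFunction lam (geometricSeriesUnion n p m ν ε) : ℝ) : ℂ)
      = Φ ((((f ε)⁻¹ : ℝ) : ℂ), H) := by
    rw [zpow_mul_schurFunction_eq hp hm₁ hm hε hne hlam, Complex.ofReal_mul]
    exact congrArg _ (Complex.ofRealHom.map_det _)
  rw [hleft]
  exact hfinal

end
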